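/- Let $M$ be a connected Hausdorff smooth ($C^\infty$) manifold of finite dimension, without boundary, and let $g$ be a semi-Riemannian metric on $M$, that is, a smooth field of symmetric non-degenerate bilinear forms on the tangent spaces of $M$. Let $0<b<\infty$ and let $\gamma:[0,b)\to M$ be a geodesic of $g$, that is, a smooth curve with $\frac{D\gamma'}{ds}=0$ on $[0,b)$, where $\frac{D}{ds}$ is the covariant derivative along $\gamma$ of the Levi-Civita connection of $g$. Then the following statements are equivalent: (i) $\gamma$ is extendible beyond $b$, i.e. there are $b'>b$ and a geodesic $\sigma:[0,b')\to M$ of $g$ with $\sigma|_{[0,b)}=\gamma$; (ii) for some complete smooth Riemannian metric $g_R$ on $M$, the function $|\gamma'|_R=g_R(\gamma',\gamma')^{1/2}$ is bounded on $[0,b)$; (ii') for every complete smooth Riemannian metric $g_R$ on $M$, the function $|\gamma'|_R=g_R(\gamma',\gamma')^{1/2}$ is bounded on $[0,b)$; (iii) there exists a strictly increasing sequence $(s_n)_n$ in $[0,b)$ with $s_n\to b$ such that $(\gamma'(s_n))_n$ converges in the tangent bundle $TM$. Here a Riemannian metric is called complete if its associated distance (the infimum of the lengths of $C^1$ curves)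 is complete. -/

import Mathlib

open scoped Manifold ContDiff Topology ENNReal Bundle

noncomputable section

namespace SemiRiemannian

variable {E : Type*} [NormedAddCommGroup E] [NormedSpace ℝ E]
  {M : Type*} [TopologicalSpace M] [ChartedSpace E M] [IsManifold 𝓘(ℝ, E) ∞ M]

variable (E M) in
/-- A smooth semi-Riemannian metric on `M`: a smooth field of symmetric, non-degenerate bilinear
forms on the tangent spaces. (On a connected manifold its index is automatically constant.) -/
structure Metric where
  /-- The scalar product on each tangent space. -/
  val (x : M) : TangentSpace 𝓘(ℝ, E) x →L[ℝ] TangentSpace 𝓘(ℝ, E) x →L[ℝ] ℝ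
  symm (x : M) (v w : TangentSpace 𝓘(ℝ, E) x) : val x v w = val x w v
  nondegenerate (x : M) (v : TangentSpace 𝓘(ℝ, E) x) (hv : ∀ w, val x v w = 0) : v = 0
  contMDiff : ContMDiff 𝓘(ℝ, E) (𝓘(ℝ, E).prod 𝓘(ℝ, E →L[ℝ] E →L[ℝ] ℝ)) ∞
    (fun x ↦ Bundle.TotalSpace.mk' (E →L[ℝ] E →L[ℝ] ℝ)
      (E := fun x : M ↦ TangentSpace 𝓘(ℝ, E) x →L[ℝ] TangentSpace 𝓘(ℝ, E) x →L[ℝ] ℝ) x (val x))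

/-- The metric `g` read in the chart `φ` at `p`: the pullback of `g` by `φ⁻¹`, a field of bilinear
forms on the (open) image of `φ` in `E`.
(As types, the tangent spaces of `M` are all `E`; `B` and `A` only use this to be composed.) -/
def Metric.inChart (g : Metric E M) (p : M) (y : E) : E →L[ℝ] E →L[ℝ] ℝ :=
  letI B : E →L[ℝ] E →L[ℝ] ℝ := g.val ((extChartAt 𝓘(ℝ, E) p).symm y)
  letI A : E →L[ℝ] E := mfderiv 𝓘(ℝ, E) 𝓘(ℝ, E) (extChartAt 𝓘(ℝ, E) p).symm y
  B.bilinearComp A A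

/-- The Christoffel symbols of the Levi-Civita connection of `g` in the chart at `p`. With `G` the
metric in the chart, `Γ_y(u, v)` is the vector such that for all `w`
`G_y(Γ_y(u, v), w) = 1/2 (DG_y(u)(v, w) + DG_y(v)(u, w) - DG_y(w)(u, v))`. -/
def Metric.christoffel (g : Metric E M) (p : M) (y u v : E) : E :=
  (g.inChart p y).inverse ((1 / 2 : ℝ) •
    (fderiv ℝ (g.inChart p) y u v + fderiv ℝ (g.inChart p) y v u
      - ((fderiv ℝ (g.inChart p) y).flip u).flip v))

/-- The velocity at time `t` of a curve `γ` with domain of definition `s ⊆ ℝ`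
(one-sided at the endpoints of an interval `s` which belong to `s`). -/
def velocity (γ : ℝ → M) (s : Set ℝ) (t : ℝ) : TangentSpace 𝓘(ℝ, E) (γ t) :=
  mfderivWithin 𝓘(ℝ, ℝ) 𝓘(ℝ, E) γ s t (1 : ℝ)

/-- The coordinates, in the chart at `p`, of the acceleration `D γ' / ds` at time `t` of a curve `γ`
with domain of definition `s ⊆ ℝ`: if `u` is `γ` read in the chart, this is `u'' + Γ_u(u', u')`. -/
def Metric.acceleration (g : Metric E M) (p : M) (γ : ℝ → M) (s : Set ℝ) (t : ℝ) : E :=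
  letI u : ℝ → E := fun τ ↦ extChartAt 𝓘(ℝ, E) p (γ τ)
  derivWithin (derivWithin u s) s t
    + g.christoffel p (u t) (derivWithin u s t) (derivWithin u s t)

/-- `γ` restricted to `s` is a geodesic of `g`: it is smooth and its acceleration vanishes
(in all the charts of the manifold). -/
def Metric.IsGeodesicOn (g : Metric E M) (γ : ℝ → M) (s : Set ℝ) : Prop :=
  ContMDiffOn 𝓘(ℝ, ℝ) 𝓘(ℝ, E) ∞ γ s ∧
    ∀ t ∈ s, ∀ p : M, γ t ∈ (extChartAt 𝓘(ℝ, E) p).source → g.acceleration p γ s t = 0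

/-- The geodesic `γ : [0, b) → M` is extendible beyond `b`: it is the restriction of a geodesic
defined on `[0, b')` for some `b' > b`. -/
def Metric.IsExtendibleBeyond (g : Metric E M) (γ : ℝ → M) (b : ℝ) : Prop :=
  ∃ b' > b, ∃ σ : ℝ → M, g.IsGeodesicOn σ (Set.Ico 0 b') ∧ Set.EqOn σ γ (Set.Ico 0 b)

variable (E M) in
/-- Smooth Riemannian metrics on `M`. -/
abbrev RiemMetric : Type _ :=
  Bundle.ContMDiffRiemannianMetric 𝓘(ℝ, E) ∞ E (fun x : M ↦ TangentSpace 𝓘(ℝ, E) x)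

/-- The distance of a Riemannian metric: the infimum of the lengths of `C¹` curves. -/
def riemDist (gR : RiemMetric E M) (x y : M) : ℝ≥0∞ :=
  letI : Bundle.RiemannianBundle (fun x : M ↦ TangentSpace 𝓘(ℝ, E) x) := ⟨gR.toRiemannianMetric⟩
  Manifold.riemannianEDist 𝓘(ℝ, E) x y

/-- A Riemannian metric is complete if its distance is: each Cauchy sequence converges. -/
def IsCompleteMetric (gR : RiemMetric E M) : Prop :=
  ∀ x : ℕ → M, (∀ ε > 0, ∃ N, ∀ m ≥ N, ∀ n ≥ N, riemDist gR (x m) (x n) < ε) →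
    ∃ y : M, Filter.Tendsto (fun n ↦ riemDist gR (x n) y) Filter.atTop (𝓝 0)

/-- The norm `|γ'|_R = g_R(γ', γ')^{1/2}` is bounded along the curve `γ` with domain `s`. -/
def BoundedSpeedOn (gR : RiemMetric E M) (γ : ℝ → M) (s : Set ℝ) : Prop :=
  ∃ C : ℝ, ∀ t ∈ s, √(gR.inner (γ t) (velocity γ s t) (velocity γ s t)) ≤ C

end SemiRiemannian

end

noncomputable section

namespace SemiRiemannian

open Set Filter

set_option synthInstance.maxHeartbeats 400000
set_option maxHeartbeats 1000000

section Charts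

variable {E : Type*} [NormedAddCommGroup E] [NormedSpace ℝ E]
  {M : Type*} [TopologicalSpace M] [ChartedSpace E M]

/-! ### The metric in a chart -/

/-! In a chart, position and velocity of a geodesic form an integral curve of a smooth vector field,
the geodesic spray. Near any point of phase space its flow exists for a uniform time `ε`. If the
velocities at times `s n → b` converge, the flow started at `s n` with `b - s n < ε` runs past `b`;
by uniqueness it agrees with `γ` before `b`, and the two are glued
(`Metric.isExtendibleBeyond_of_tendsto_chartLift`). Conversely, an extension has a continuous
velocity on the compact interval `[0, b]`, so velocities converge at `b` and are bounded for every
Riemannian metric.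

If the speed is bounded for a complete Riemannian metric, `γ` is Lipschitz on an interval of finite
length, so `γ (s n)` is Cauchy and converges to some `y`. In the chart at `y` the coordinate
velocities are then bounded, a subsequence of them converges, and the previous argument applies
(`Metric.isExtendibleBeyond_of_boundedSpeedOn`).

Passing from "every" to "some" complete metric requires that one exist, although `M` is not assumed
second countable. The geodesics of `g` supply this (`Metric.secondCountableTopology`). Every point
has a neighborhood whose points reach it by geodesics of a common duration `1 / (n + 1)`. By
continuous dependence and the Lindelöf property of `E × E`, the geodesics of given duration issuing
from one chart domain end in countably many chart domains. A countable family of chart domains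
stable under this operation has a clopen union, hence covers `M`. One then takes a smooth function
`f` with relatively compact sublevels and, by a partition of unity, a Riemannian metric with `df² ≤
g_R`. As `f` is 1-Lipschitz, a Cauchy sequence stays in a compact set (`exists_isCompleteMetric`).
-/

lemma extChartAt_target_mem_nhds_of_mem {p : M} {y : E} (hy : y ∈ (extChartAt 𝓘(ℝ, E) p).target) :
    (extChartAt 𝓘(ℝ, E) p).target ∈ 𝓝 y :=
  (isOpen_extChartAt_target p).mem_nhds hy

lemma extChartAt_source_mem_nhds_of_mem {p x : M} (hx : x ∈ (extChartAt 𝓘(ℝ, E) p).source) :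
    (extChartAt 𝓘(ℝ, E) p).source ∈ 𝓝 x :=
  (isOpen_extChartAt_source p).mem_nhds hx

variable [IsManifold 𝓘(ℝ, E) ∞ M]

lemma contMDiffAt_extChartAt_symm_of_mem {p : M} {y : E}
    (hy : y ∈ (extChartAt 𝓘(ℝ, E) p).target) :
    ContMDiffAt 𝓘(ℝ, E) 𝓘(ℝ, E) ∞ (extChartAt 𝓘(ℝ, E) p).symm y :=
  (contMDiffOn_extChartAt_symm (I := 𝓘(ℝ, E)) p).contMDiffAt (extChartAt_target_mem_nhds_of_mem hy)

lemma contMDiffAt_extChartAt_of_mem {p x : M} (hx : x ∈ (extChartAt 𝓘(ℝ, E) p).source) :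
    ContMDiffAt 𝓘(ℝ, E) 𝓘(ℝ, E) ∞ (extChartAt 𝓘(ℝ, E) p) x :=
  contMDiffAt_extChartAt' (by simpa using hx)

lemma mdifferentiableAt_extChartAt_symm_of_mem {p : M} {y : E}
    (hy : y ∈ (extChartAt 𝓘(ℝ, E) p).target) :
    MDifferentiableAt 𝓘(ℝ, E) 𝓘(ℝ, E) (extChartAt 𝓘(ℝ, E) p).symm y :=
  (contMDiffAt_extChartAt_symm_of_mem hy).mdifferentiableAt (by simp)

lemma isInvertible_mfderiv_extChartAt_symm {p : M} {y : E}
    (hy : y ∈ (extChartAt 𝓘(ℝ, E) p).target) :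
    (mfderiv 𝓘(ℝ, E) 𝓘(ℝ, E) (extChartAt 𝓘(ℝ, E) p).symm y).IsInvertible := by
  have := isInvertible_mfderivWithin_extChartAt_symm (I := 𝓘(ℝ, E)) hy
  rwa [ModelWithCorners.range_eq_univ, mfderivWithin_univ] at this

variable (g : Metric E M)

lemma Metric.inChart_apply (p : M) (y u w : E) :
    g.inChart p y u w = g.val ((extChartAt 𝓘(ℝ, E) p).symm y)
      (mfderiv 𝓘(ℝ, E) 𝓘(ℝ, E) (extChartAt 𝓘(ℝ, E) p).symm y u)
      (mfderiv 𝓘(ℝ, E) 𝓘(ℝ, E) (extChartAt 𝓘(ℝ, E) p).symm y w) := rfl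

lemma contMDiffAt_mfderiv_extChartAt_symm_apply {p : M} {y : E}
    (hy : y ∈ (extChartAt 𝓘(ℝ, E) p).target) (u : E) :
    ContMDiffAt 𝓘(ℝ, E) (𝓘(ℝ, E).prod 𝓘(ℝ, E)) ∞
      (fun y ↦ Bundle.TotalSpace.mk' E (E := fun x : M ↦ TangentSpace 𝓘(ℝ, E) x)
        ((extChartAt 𝓘(ℝ, E) p).symm y)
        (mfderiv 𝓘(ℝ, E) 𝓘(ℝ, E) (extChartAt 𝓘(ℝ, E) p).symm y u)) y := by
  have h1 := (contMDiffOn_extChartAt_symm (I := 𝓘(ℝ, E)) (n := ∞) p).contMDiffOn_tangentMapWithin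
    (m := ∞) (by simp) (isOpen_extChartAt_target p).uniqueMDiffOn
  have h2 : ContMDiffAt 𝓘(ℝ, E) (𝓘(ℝ, E).prod 𝓘(ℝ, E)) ∞
      (fun y ↦ (⟨y, u⟩ : TangentBundle 𝓘(ℝ, E) E)) y :=
    contMDiffAt_vectorSpace_iff_contDiffAt.2 contDiffAt_const
  have h3 := (h1 (⟨y, u⟩ : TangentBundle 𝓘(ℝ, E) E) hy).comp_of_eq
    (f := fun y ↦ (⟨y, u⟩ : TangentBundle 𝓘(ℝ, E) E)) h2.contMDiffWithinAt
    (s := (extChartAt 𝓘(ℝ, E) p).target) (fun z hz ↦ hz) rfl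
  refine (h3.contMDiffAt (extChartAt_target_mem_nhds_of_mem hy)).congr_of_eventuallyEq ?_
  filter_upwards [extChartAt_target_mem_nhds_of_mem hy] with z hz
  simp only [Function.comp, tangentMapWithin,
    mfderivWithin_of_mem_nhds (extChartAt_target_mem_nhds_of_mem hz)]

lemma Metric.contDiffOn_inChart [FiniteDimensional ℝ E] (p : M) :
    ContDiffOn ℝ ∞ (g.inChart p) (extChartAt 𝓘(ℝ, E) p).target := by
  rw [contDiffOn_clm_apply]
  intro u
  rw [contDiffOn_clm_apply]
  intro w y hy
  have hg := (g.contMDiff.contMDiffAt (x := (extChartAt 𝓘(ℝ, E) p).symm y)).comp y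
    (contMDiffAt_extChartAt_symm_of_mem hy)
  have := ContMDiffAt.clm_bundle_apply₂ (F₁ := E) (F₂ := E) (F₃ := ℝ)
    (E₁ := fun x : M ↦ TangentSpace 𝓘(ℝ, E) x) (E₂ := fun x : M ↦ TangentSpace 𝓘(ℝ, E) x)
    (E₃ := fun _ ↦ ℝ) hg (contMDiffAt_mfderiv_extChartAt_symm_apply hy u)
    (contMDiffAt_mfderiv_extChartAt_symm_apply hy w)
  rw [Bundle.contMDiffAt_totalSpace] at this
  exact (this.2.contDiffAt).contDiffWithinAt

lemma Metric.inChart_symm (p : M) (y u w : E) : g.inChart p y u w = g.inChart p y w u := by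
  rw [g.inChart_apply, g.inChart_apply, g.symm]

lemma exists_equiv_eq_mfderiv_extChartAt_symm {p : M} {y : E}
    (hy : y ∈ (extChartAt 𝓘(ℝ, E) p).target) :
    ∃ A : E ≃L[ℝ] E, ∀ v : E,
      mfderiv 𝓘(ℝ, E) 𝓘(ℝ, E) (extChartAt 𝓘(ℝ, E) p).symm y v = A v := by
  obtain ⟨A, hA⟩ := isInvertible_mfderiv_extChartAt_symm hy
  exact ⟨A, fun v ↦ by rw [← hA]; rfl⟩

/-- Non-degeneracy is injectivity of the map into the dual, which suffices in finite dimension.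
Hence `inverse` in the Christoffel symbols is a genuine inverse and not its default value. -/
lemma Metric.isInvertible_inChart [FiniteDimensional ℝ E] {p : M} {y : E}
    (hy : y ∈ (extChartAt 𝓘(ℝ, E) p).target) : (g.inChart p y).IsInvertible := by
  obtain ⟨A, hA⟩ := exists_equiv_eq_mfderiv_extChartAt_symm hy
  have hinj : Function.Injective (g.inChart p y) := by
    rw [injective_iff_map_eq_zero]
    intro v hv
    have h0 : A v = 0 := by
      refine g.nondegenerate ((extChartAt 𝓘(ℝ, E) p).symm y) (A v) fun w ↦ ?_
      have h1 : g.inChart p y v (A.symm w) = 0 := by rw [hv]; rfl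
      rw [Metric.inChart_apply, hA, hA] at h1
      have h2 : A (A.symm w) = w := A.apply_symm_apply w
      rwa [h2] at h1
    exact A.map_eq_zero_iff.1 h0
  have hfr : Module.finrank ℝ E = Module.finrank ℝ (E →L[ℝ] ℝ) := by
    rw [← (LinearMap.toContinuousLinearMap (𝕜 := ℝ) (E := E) (F' := ℝ)).finrank_eq]
    simp
  exact ⟨(LinearEquiv.ofInjectiveOfFinrankEq (g.inChart p y).toLinearMap hinj
    hfr).toContinuousLinearEquiv, by ext; rfl⟩

end Charts

/-! ### Derivatives of fields of bilinear forms -/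

section Bilinear

variable {E F : Type*} [NormedAddCommGroup E] [NormedSpace ℝ E] [NormedAddCommGroup F]
  [NormedSpace ℝ F]

lemma hasDerivAt_comp_of_contDiffAt {G : E → F} {c : ℝ → E} {c' : E} {t : ℝ}
    (h : ContDiffAt ℝ ∞ G (c t)) (hc : HasDerivAt c c' t) :
    HasDerivAt (fun s ↦ G (c s)) (fderiv ℝ G (c t) c') t :=
  (h.differentiableAt (by simp)).hasFDerivAt.comp_hasDerivAt t hc

lemma hasDerivAt_clm_apply₂ {G : ℝ → E →L[ℝ] E →L[ℝ] F} {G' : E →L[ℝ] E →L[ℝ] F} {a b : ℝ → E}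
    {a' b' : E} {t : ℝ} (h : HasDerivAt G G' t) (ha : HasDerivAt a a' t) (hb : HasDerivAt b b' t) :
    HasDerivAt (fun s ↦ G s (a s) (b s)) (G' (a t) (b t) + G t a' (b t) + G t (a t) b') t :=
  (h.clm_apply ha).clm_apply hb

lemma hasDerivAt_bilinear_apply {G : E → E →L[ℝ] E →L[ℝ] ℝ} {c a b : ℝ → E} {c' a' b' : E} {t : ℝ}
    (h : ContDiffAt ℝ ∞ G (c t)) (hc : HasDerivAt c c' t) (ha : HasDerivAt a a' t)
    (hb : HasDerivAt b b' t) :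
    HasDerivAt (fun s ↦ G (c s) (a s) (b s))
      (fderiv ℝ G (c t) c' (a t) (b t) + G (c t) a' (b t) + G (c t) (a t) b') t := by
  have h1 : HasDerivAt (fun s ↦ G (c s)) (fderiv ℝ G (c t) c') t :=
    hasDerivAt_comp_of_contDiffAt (F := E →L[ℝ] E →L[ℝ] ℝ) h hc
  exact hasDerivAt_clm_apply₂ h1 ha hb

lemma hasDerivAt_bilinear_apply_const {G : E → E →L[ℝ] E →L[ℝ] ℝ} {c : ℝ → E} {c' : E} {t : ℝ}
    (h : ContDiffAt ℝ ∞ G (c t)) (hc : HasDerivAt c c' t) (a b : E) :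
    HasDerivAt (fun s ↦ G (c s) a b) (fderiv ℝ G (c t) c' a b) t := by
  simpa using hasDerivAt_bilinear_apply h hc (hasDerivAt_const t a) (hasDerivAt_const t b)

lemma hasDerivAt_fderiv_apply_const {f : E → F} {c : ℝ → E} {c' : E} {t : ℝ}
    (h : ContDiffAt ℝ ∞ f (c t)) (hc : HasDerivAt c c' t) (u : E) :
    HasDerivAt (fun s ↦ fderiv ℝ f (c s) u) (fderiv ℝ (fderiv ℝ f) (c t) c' u) t := by
  simpa using (hasDerivAt_comp_of_contDiffAt (h.fderiv_right (m := ∞) (by simp)) hc).clm_apply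
    (hasDerivAt_const t u)

lemma contDiffAt_bilinear_apply {G : E → E →L[ℝ] E →L[ℝ] ℝ} {x : E × E × E}
    (h : ContDiffAt ℝ ∞ G x.1) : ContDiffAt ℝ ∞ (fun x : E × E × E ↦ G x.1 x.2.1 x.2.2) x := by
  have h1 : ContDiffAt ℝ ∞ (fun x : E × E × E ↦ G x.1) x :=
    ContDiffAt.comp (g := G) x h contDiffAt_fst
  have h2 : ContDiffAt ℝ ∞ (fun x : E × E × E ↦ x.2.1) x := by fun_prop
  have h3 : ContDiffAt ℝ ∞ (fun x : E × E × E ↦ x.2.2) x := by fun_prop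
  exact (h1.clm_apply h2).clm_apply h3

/-- Replaces the derivative of an operator-valued map by that of a scalar function on `E × E × E`;
the smoothness of the spray is checked in this form. -/
lemma fderiv_bilinear_apply {G : E → E →L[ℝ] E →L[ℝ] ℝ} {y : E} (h : ContDiffAt ℝ ∞ G y)
    (u a b : E) :
    fderiv ℝ G y u a b = fderiv ℝ (fun x : E × E × E ↦ G x.1 x.2.1 x.2.2) (y, a, b) (u, 0, 0) := by
  have hc : HasDerivAt (fun s : ℝ ↦ y + s • u) u 0 := by
    simpa using ((hasDerivAt_id (0 : ℝ)).smul_const u).const_add y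
  have hy : y + (0 : ℝ) • u = y := by simp
  have h1 := hasDerivAt_bilinear_apply (c := fun s : ℝ ↦ y + s • u) (t := 0) (by simpa using h)
    hc (hasDerivAt_const 0 a) (hasDerivAt_const 0 b)
  have h2 := hasDerivAt_comp_of_contDiffAt (c := fun s : ℝ ↦ (y + s • u, a, b)) (t := 0)
    (contDiffAt_bilinear_apply (G := G) (x := (y + (0 : ℝ) • u, a, b)) (by simpa using h))
    (hc.prodMk ((hasDerivAt_const 0 a).prodMk (hasDerivAt_const 0 b)))
  have h3 := h1.unique h2
  simp only [hy, map_zero, add_zero] at h3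
  simpa using h3

lemma fderiv_fderiv_symm_apply {f : E → F} {y : E} (hf : ContDiffAt ℝ ∞ f y) (u w : E) :
    fderiv ℝ (fderiv ℝ f) y u w = fderiv ℝ (fderiv ℝ f) y w u :=
  (hf.isSymmSndFDerivAt (by simpa using WithTop.coe_le_coe.2 (le_top : (2 : ℕ∞) ≤ ⊤))) u w

end Bilinear

/-! ### Changes of charts -/

section ChartChange

variable {E : Type*} [NormedAddCommGroup E] [NormedSpace ℝ E]
  {M : Type*} [TopologicalSpace M] [ChartedSpace E M]

/-- The change of charts from the chart at `p` to the chart at `q`. -/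
def chartChange (p q : M) (y : E) : E := extChartAt 𝓘(ℝ, E) q ((extChartAt 𝓘(ℝ, E) p).symm y)

variable [IsManifold 𝓘(ℝ, E) ∞ M]

lemma contDiffAt_chartChange {p q : M} {y : E} (hy : y ∈ (extChartAt 𝓘(ℝ, E) p).target)
    (hq : (extChartAt 𝓘(ℝ, E) p).symm y ∈ (extChartAt 𝓘(ℝ, E) q).source) :
    ContDiffAt ℝ ∞ (chartChange (E := E) p q) y :=
  ((contMDiffAt_extChartAt_of_mem hq).comp y (contMDiffAt_extChartAt_symm_of_mem hy)).contDiffAt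

lemma eventually_mem_target_and_symm_mem_source {p q : M} {y : E}
    (hy : y ∈ (extChartAt 𝓘(ℝ, E) p).target)
    (hq : (extChartAt 𝓘(ℝ, E) p).symm y ∈ (extChartAt 𝓘(ℝ, E) q).source) :
    ∀ᶠ z in 𝓝 y, z ∈ (extChartAt 𝓘(ℝ, E) p).target ∧
      (extChartAt 𝓘(ℝ, E) p).symm z ∈ (extChartAt 𝓘(ℝ, E) q).source :=
  (eventually_mem_set.2 (extChartAt_target_mem_nhds_of_mem hy)).and
    ((contMDiffAt_extChartAt_symm_of_mem hy).continuousAt.eventually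
      (extChartAt_source_mem_nhds_of_mem hq))

variable (g : Metric E M)

lemma Metric.christoffel_zero (p : M) (y : E) : g.christoffel p y 0 0 = 0 := by
  simp [Metric.christoffel]

/-- The chain rule for `φ_p⁻¹ = φ_q⁻¹ ∘ ψ`, where `ψ` is the change of charts. -/
lemma Metric.inChart_eq_chartChange {p q : M} {y : E} (hy : y ∈ (extChartAt 𝓘(ℝ, E) p).target)
    (hq : (extChartAt 𝓘(ℝ, E) p).symm y ∈ (extChartAt 𝓘(ℝ, E) q).source) (u w : E) :
    g.inChart p y u w = g.inChart q (chartChange p q y)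
      (fderiv ℝ (chartChange (E := E) p q) y u) (fderiv ℝ (chartChange (E := E) p q) y w) := by
  have hx : (extChartAt 𝓘(ℝ, E) q).symm (chartChange p q y) = (extChartAt 𝓘(ℝ, E) p).symm y :=
    (extChartAt 𝓘(ℝ, E) q).left_inv hq
  have hty : chartChange p q y ∈ (extChartAt 𝓘(ℝ, E) q).target :=
    (extChartAt 𝓘(ℝ, E) q).map_source hq
  have hD : ∀ u : E, (mfderiv 𝓘(ℝ, E) 𝓘(ℝ, E) (extChartAt 𝓘(ℝ, E) p).symm y u : E) =
      (mfderiv 𝓘(ℝ, E) 𝓘(ℝ, E) (extChartAt 𝓘(ℝ, E) q).symm (chartChange p q y)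
        (fderiv ℝ (chartChange (E := E) p q) y u) : E) := by
    intro u
    have h1 : (extChartAt 𝓘(ℝ, E) p).symm =ᶠ[𝓝 y]
        (extChartAt 𝓘(ℝ, E) q).symm ∘ chartChange p q := by
      filter_upwards [eventually_mem_target_and_symm_mem_source hy hq] with z hz
      exact ((extChartAt 𝓘(ℝ, E) q).left_inv hz.2).symm
    have h2 := mfderiv_comp y (mdifferentiableAt_extChartAt_symm_of_mem hty)
      ((contDiffAt_chartChange hy hq).differentiableAt (by simp)).mdifferentiableAt
    rw [h1.mfderiv_eq]
    erw [h2, mfderiv_eq_fderiv]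
    rfl
  have hv : ∀ x x' : M, x' = x → ∀ a b a' b' : E, a = a' → b = b' →
      (g.val x : E →L[ℝ] E →L[ℝ] ℝ) a b = (g.val x' : E →L[ℝ] E →L[ℝ] ℝ) a' b' := by
    rintro x _ rfl a b _ _ rfl rfl; rfl
  exact hv _ _ hx _ _ _ _ (hD u) (hD w)

end ChartChange

/-! ### Christoffel symbols and their transformation law -/

section Christoffel

variable {E : Type*} [NormedAddCommGroup E] [NormedSpace ℝ E] [FiniteDimensional ℝ E]
  {M : Type*} [TopologicalSpace M] [ChartedSpace E M] [IsManifold 𝓘(ℝ, E) ∞ M]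
  (g : Metric E M)

lemma Metric.contDiffAt_inChart {p : M} {y : E} (hy : y ∈ (extChartAt 𝓘(ℝ, E) p).target) :
    ContDiffAt ℝ ∞ (g.inChart p) y :=
  (g.contDiffOn_inChart p).contDiffAt (extChartAt_target_mem_nhds_of_mem hy)

lemma Metric.inChart_christoffel {p : M} {y : E} (hy : y ∈ (extChartAt 𝓘(ℝ, E) p).target)
    (u v w : E) :
    g.inChart p y (g.christoffel p y u v) w = 1 / 2 * (fderiv ℝ (g.inChart p) y u v w
      + fderiv ℝ (g.inChart p) y v u w - fderiv ℝ (g.inChart p) y w u v) := by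
  rw [Metric.christoffel, (g.isInvertible_inChart hy).self_apply_inverse]
  simp

/-- The geodesic spray in the chart at `p`. -/
def Metric.spray (p : M) (z : E × E) : E × E := (z.2, -g.christoffel p z.1 z.2 z.2)

lemma Metric.contDiffAt_spray {p : M} {z : E × E} (hz : z.1 ∈ (extChartAt 𝓘(ℝ, E) p).target) :
    ContDiffAt ℝ ∞ (g.spray p) z := by
  refine contDiffAt_snd.prodMk (ContDiffAt.neg ?_)
  have hG : ContDiffAt ℝ ∞ (fun z : E × E ↦ g.inChart p z.1) z :=
    (g.contDiffAt_inChart hz).comp z contDiffAt_fst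
  have hI : ContDiffAt ℝ ∞ (fun z : E × E ↦ (g.inChart p z.1).inverse) z :=
    ContDiffAt.comp (g := ContinuousLinearMap.inverse) z
      (g.isInvertible_inChart hz).contDiffAt_map_inverse hG
  have hopen : IsOpen ((extChartAt 𝓘(ℝ, E) p).target ×ˢ (univ : Set E)) :=
    (isOpen_extChartAt_target p).prod isOpen_univ
  refine hI.clm_apply (ContDiffOn.contDiffAt ?_ (hopen.mem_nhds ⟨hz, mem_univ _⟩))
  rw [contDiffOn_clm_apply]
  intro w x hx
  have hH : ∀ {y a b : E}, y ∈ (extChartAt 𝓘(ℝ, E) p).target → ContDiffAt ℝ ∞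
      (fderiv ℝ (fun x : E × E × E ↦ g.inChart p x.1 x.2.1 x.2.2)) (y, a, b) := fun hy ↦
    (contDiffAt_bilinear_apply (g.contDiffAt_inChart hy)).fderiv_right (m := ∞) (by simp)
  have h1 : ContDiffAt ℝ ∞ (fun z : E × E ↦ fderiv ℝ
      (fun x : E × E × E ↦ g.inChart p x.1 x.2.1 x.2.2) (z.1, z.2, w) (z.2, 0, 0)) x :=
    ContDiffAt.clm_apply (ContDiffAt.comp (f := fun z : E × E ↦ (z.1, z.2, w)) x (hH hx.1)
      (by fun_prop)) (by fun_prop)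
  have h2 : ContDiffAt ℝ ∞ (fun z : E × E ↦ fderiv ℝ
      (fun x : E × E × E ↦ g.inChart p x.1 x.2.1 x.2.2) (z.1, z.2, z.2) (w, 0, 0)) x :=
    ContDiffAt.clm_apply (ContDiffAt.comp (f := fun z : E × E ↦ (z.1, z.2, z.2)) x (hH hx.1)
      (by fun_prop)) (by fun_prop)
  refine (((contDiffAt_const (c := (1 / 2 : ℝ))).mul
    ((h1.add h1).sub h2)).contDiffWithinAt).congr_of_mem (fun y hy ↦ ?_) hx
  rw [← fderiv_bilinear_apply (g.contDiffAt_inChart hy.1),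
    ← fderiv_bilinear_apply (g.contDiffAt_inChart hy.1)]
  simp

/-- Obtained by differentiating the transformation law of the metric along a line with direction
`c`. -/
lemma Metric.fderiv_inChart_eq_chartChange {p q : M} {y : E}
    (hy : y ∈ (extChartAt 𝓘(ℝ, E) p).target)
    (hq : (extChartAt 𝓘(ℝ, E) p).symm y ∈ (extChartAt 𝓘(ℝ, E) q).source) (c u w : E) :
    fderiv ℝ (g.inChart p) y c u w =
      fderiv ℝ (g.inChart q) (chartChange p q y) (fderiv ℝ (chartChange (E := E) p q) y c)
        (fderiv ℝ (chartChange (E := E) p q) y u) (fderiv ℝ (chartChange (E := E) p q) y w)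
      + g.inChart q (chartChange p q y) (fderiv ℝ (fderiv ℝ (chartChange (E := E) p q)) y c u)
        (fderiv ℝ (chartChange (E := E) p q) y w)
      + g.inChart q (chartChange p q y) (fderiv ℝ (chartChange (E := E) p q) y u)
        (fderiv ℝ (fderiv ℝ (chartChange (E := E) p q)) y c w) := by
  obtain ⟨ℓ, h0, hℓ⟩ : ∃ ℓ : ℝ → E, ℓ 0 = y ∧ HasDerivAt ℓ c 0 :=
    ⟨fun s ↦ y + s • c, by simp,
      by simpa using ((hasDerivAt_id (0 : ℝ)).smul_const c).const_add y⟩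
  subst h0
  have hψ := contDiffAt_chartChange hy hq
  have hL := hasDerivAt_bilinear_apply_const (g.contDiffAt_inChart hy) hℓ u w
  have hR := hasDerivAt_bilinear_apply (c := fun s ↦ chartChange p q (ℓ s))
    (g.contDiffAt_inChart ((extChartAt 𝓘(ℝ, E) q).map_source hq))
    (hasDerivAt_comp_of_contDiffAt hψ hℓ) (hasDerivAt_fderiv_apply_const hψ hℓ u)
    (hasDerivAt_fderiv_apply_const hψ hℓ w)
  refine hL.unique (hR.congr_of_eventuallyEq ?_)
  filter_upwards [hℓ.continuousAt.eventually (eventually_mem_target_and_symm_mem_source hy hq)]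
    with s hs
  exact g.inChart_eq_chartChange hs.1 hs.2 u w

/-- Pair both sides with `Dψ w` and use the Koszul formula in both charts. By symmetry of `D²ψ` and
of the metric, the terms with `D²ψ(u, w)` cancel, and only `D²ψ(u, u)` paired with `Dψ w` survives.
-/
lemma Metric.fderiv_chartChange_christoffel {p q : M} {y : E}
    (hy : y ∈ (extChartAt 𝓘(ℝ, E) p).target)
    (hq : (extChartAt 𝓘(ℝ, E) p).symm y ∈ (extChartAt 𝓘(ℝ, E) q).source) (u : E) :
    fderiv ℝ (chartChange (E := E) p q) y (g.christoffel p y u u) =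
      g.christoffel q (chartChange p q y) (fderiv ℝ (chartChange (E := E) p q) y u)
        (fderiv ℝ (chartChange (E := E) p q) y u)
      + fderiv ℝ (fderiv ℝ (chartChange (E := E) p q)) y u u := by
  have hty : chartChange p q y ∈ (extChartAt 𝓘(ℝ, E) q).target :=
    (extChartAt 𝓘(ℝ, E) q).map_source hq
  have hψ := contDiffAt_chartChange hy hq
  obtain ⟨e, he⟩ := g.isInvertible_inChart hty
  obtain ⟨ep, hep⟩ := g.isInvertible_inChart hy
  apply e.injective
  set D := fderiv ℝ (chartChange (E := E) p q) y with hD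
  -- If `D v = 0`, then `v` is orthogonal to everything in the chart at `p`, so `v = 0`;
  -- surjectivity follows by dimension.
  have hDsurj : Function.Surjective D := by
    have hinj : Function.Injective D := by
      rw [injective_iff_map_eq_zero]
      intro v hv
      apply ep.map_eq_zero_iff.1
      ext w
      have : g.inChart p y v w = 0 := by
        rw [g.inChart_eq_chartChange hy hq, ← hD, hv]; simp
      rw [← hep] at this
      simpa using this
    exact LinearMap.surjective_of_injective (f := D.toLinearMap) hinj
  ext w'
  obtain ⟨w, rfl⟩ := hDsurj w'
  have hee : ∀ a b : E, e a b = g.inChart q (chartChange p q y) a b := by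
    intro a b; rw [← he]; rfl
  rw [map_add, add_apply, hee, hee, hee, hD,
    ← g.inChart_eq_chartChange hy hq, g.inChart_christoffel hy, g.inChart_christoffel hty,
    g.fderiv_inChart_eq_chartChange hy hq, g.fderiv_inChart_eq_chartChange hy hq,
    fderiv_fderiv_symm_apply hψ w u,
    g.inChart_symm q _ (fderiv ℝ (chartChange (E := E) p q) y u)
      (fderiv ℝ (fderiv ℝ (chartChange (E := E) p q)) y u w)]
  ring

end Christoffel

/-! ### Local flows of vector fields -/

section Flow

variable {V : Type*} [NormedAddCommGroup V] [NormedSpace ℝ V]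

/-- Picard–Lindelöf, with radius and time shrunk by joint continuity so that all solutions stay in
`U`. The existence time and the Lipschitz constant are common to all initial values in the ball. -/
lemma exists_local_flow [CompleteSpace V] {F : V → V} {x₀ : V} (hF : ContDiffAt ℝ 1 F x₀)
    {U : Set V} (hU : U ∈ 𝓝 x₀) :
    ∃ r > 0, ∃ ε > 0, ∃ α : V → ℝ → V, ∃ L : NNReal,
      (∀ x ∈ Metric.closedBall x₀ r, α x 0 = x ∧
        ∀ t ∈ Icc (-ε) ε, HasDerivAt (α x) (F (α x t)) t ∧ α x t ∈ U) ∧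
      ContinuousOn (Function.uncurry α) (Metric.closedBall x₀ r ×ˢ Icc (-ε) ε) ∧
      ∀ t ∈ Icc (-ε) ε, LipschitzOnWith L (α · t) (Metric.closedBall x₀ r) := by
  obtain ⟨ε, hε, a, r, L, K, hr, hpl⟩ := IsPicardLindelof.of_contDiffAt_one hF
  obtain ⟨α, hα, L', hL'⟩ :=
    (hpl 0).exists_forall_mem_closedBall_eq_hasDerivWithinAt_lipschitzOnWith
  simp only [zero_sub, zero_add] at hα hL'
  have hcont : ContinuousOn (Function.uncurry α) (Metric.closedBall x₀ r ×ˢ Icc (-ε) ε) :=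
    continuousOn_prod_of_continuousOn_lipschitzOnWith _ L'
      (fun x hx ↦ HasDerivWithinAt.continuousOn (hα x hx).2) hL'
  have hr' : (0 : ℝ) < r := hr
  have hmem : Metric.closedBall x₀ (r : ℝ) ×ˢ Icc (-ε) ε ∈ 𝓝 (x₀, (0 : ℝ)) :=
    prod_mem_nhds (Metric.closedBall_mem_nhds _ hr') (Icc_mem_nhds (by linarith) hε)
  have hca : ContinuousAt (Function.uncurry α) (x₀, 0) := hcont.continuousAt hmem
  have h0 : Function.uncurry α (x₀, 0) = x₀ := (hα x₀ (Metric.mem_closedBall_self hr'.le)).1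
  have hpre : Function.uncurry α ⁻¹' U ∈ 𝓝 (x₀, (0 : ℝ)) := hca.preimage_mem_nhds (by rwa [h0])
  obtain ⟨δ, hδ, hδU⟩ := Metric.mem_nhds_iff.1 hpre
  have hr1 : min (r : ℝ) (δ / 2) ≤ r := min_le_left _ _
  have he1 : min (ε / 2) (δ / 2) < ε := (min_le_left _ _).trans_lt (by linarith)
  have hsub : Icc (-min (ε / 2) (δ / 2)) (min (ε / 2) (δ / 2)) ⊆ Ioo (-ε) ε := fun t ht ↦
    ⟨by linarith [ht.1], by linarith [ht.2]⟩
  have hsub2 : Metric.closedBall x₀ (min (r : ℝ) (δ / 2)) ⊆ Metric.closedBall x₀ r :=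
    Metric.closedBall_subset_closedBall hr1
  refine ⟨min r (δ / 2), by positivity, min (ε / 2) (δ / 2), by positivity, α, L', ?_, ?_, ?_⟩
  · intro x hx
    refine ⟨(hα x (hsub2 hx)).1, fun t ht ↦ ⟨?_, ?_⟩⟩
    · exact ((hα x (hsub2 hx)).2 t (Ioo_subset_Icc_self (hsub ht))).hasDerivAt
        (Icc_mem_nhds (hsub ht).1 (hsub ht).2)
    · refine hδU (a := (x, t)) ?_
      rw [Metric.mem_ball, Prod.dist_eq, max_lt_iff]
      have h1 : dist x x₀ ≤ δ / 2 := (Metric.mem_closedBall.1 hx).trans (min_le_right _ _)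
      have h2 : |t| ≤ δ / 2 := (abs_le.2 ht).trans (min_le_right _ _)
      refine ⟨by simpa using by linarith, ?_⟩
      simp only [Real.dist_eq, sub_zero]; linarith
  · exact hcont.mono (prod_mono hsub2 (hsub.trans Ioo_subset_Icc_self))
  · exact fun t ht ↦ (hL' t (Ioo_subset_Icc_self (hsub ht))).mono hsub2

lemma contDiffAt_of_hasDerivAt_ode {F : V → V} {z : ℝ → V} {t : ℝ} {U : Set V} [CompleteSpace V]
    (hF : ContDiffOn ℝ ∞ F U)
    (hz : ∀ᶠ τ in 𝓝 t, HasDerivAt z (F (z τ)) τ ∧ z τ ∈ U) : ContDiffAt ℝ ∞ z t := by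
  obtain ⟨ε, hε, h⟩ := Metric.eventually_nhds_iff.1 hz
  have hsub : ∀ τ ∈ Icc (t - ε / 2) (t + ε / 2), dist τ t < ε := fun τ hτ ↦ by
    rw [Real.dist_eq, abs_lt]; constructor <;> linarith [hτ.1, hτ.2]
  have := ODE.contDiffOn_enat_Icc_of_hasDerivWithinAt (n := ⊤) (f := fun _ ↦ F) (u := U)
    (α := z) (tmin := t - ε / 2) (tmax := t + ε / 2)
    (hF.comp contDiffOn_snd fun x hx ↦ hx.2)
    (fun τ hτ ↦ (h (hsub τ hτ)).1.hasDerivWithinAt) (fun τ hτ ↦ (h (hsub τ hτ)).2)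
  exact this.contDiffAt (Icc_mem_nhds (by linarith) (by linarith))

end Flow

/-! ### Geodesics as integral curves of the spray; uniqueness -/

section Geodesic

variable {E : Type*} [NormedAddCommGroup E] [NormedSpace ℝ E]
  {M : Type*} [TopologicalSpace M] [ChartedSpace E M]

/-- The velocity of the curve `γ` at time `t` read in the chart at `p`. -/
def chartLift (p : M) (γ : ℝ → M) (t : ℝ) : E × E :=
  (extChartAt 𝓘(ℝ, E) p (γ t), deriv (fun τ ↦ extChartAt 𝓘(ℝ, E) p (γ τ)) t)

lemma extChartAt_comp_eventuallyEq {γ₁ γ₂ : ℝ → M} {t : ℝ} (h : γ₁ =ᶠ[𝓝 t] γ₂) (p : M) :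
    (fun τ ↦ extChartAt 𝓘(ℝ, E) p (γ₁ τ)) =ᶠ[𝓝 t] fun τ ↦ extChartAt 𝓘(ℝ, E) p (γ₂ τ) :=
  h.fun_comp (extChartAt 𝓘(ℝ, E) p)

lemma chartLift_congr {γ₁ γ₂ : ℝ → M} {t : ℝ} (h : γ₁ =ᶠ[𝓝 t] γ₂) (p : M) :
    chartLift (E := E) p γ₁ t = chartLift p γ₂ t := by
  rw [chartLift, chartLift, h.eq_of_nhds, (extChartAt_comp_eventuallyEq h p).deriv_eq]

variable [IsManifold 𝓘(ℝ, E) ∞ M] (g : Metric E M)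

/-- `γ` is smooth at `t` and its acceleration at time `t` vanishes. -/
def Metric.IsGeodesicAt (γ : ℝ → M) (t : ℝ) : Prop :=
  ContMDiffAt 𝓘(ℝ, ℝ) 𝓘(ℝ, E) ∞ γ t ∧ ∀ p : M, γ t ∈ (extChartAt 𝓘(ℝ, E) p).source →
    deriv (deriv fun τ ↦ extChartAt 𝓘(ℝ, E) p (γ τ)) t +
      g.christoffel p (chartLift p γ t).1 (chartLift p γ t).2 (chartLift p γ t).2 = 0

lemma contDiffAt_extChartAt_comp {γ : ℝ → M} {t : ℝ}
    (h : ContMDiffAt 𝓘(ℝ, ℝ) 𝓘(ℝ, E) ∞ γ t) {p : M}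
    (hp : γ t ∈ (extChartAt 𝓘(ℝ, E) p).source) :
    ContDiffAt ℝ ∞ (fun τ ↦ extChartAt 𝓘(ℝ, E) p (γ τ)) t :=
  ((contMDiffAt_extChartAt_of_mem hp).comp t h).contDiffAt

lemma contDiffAt_deriv_of_contDiffAt {u : ℝ → E} {t : ℝ} (h : ContDiffAt ℝ ∞ u t) :
    ContDiffAt ℝ ∞ (deriv u) t := by
  have := h.fderiv_right (m := ∞) (by simp)
  exact this.clm_apply contDiffAt_const

lemma contDiffAt_chartLift {γ : ℝ → M} {t : ℝ} (h : ContMDiffAt 𝓘(ℝ, ℝ) 𝓘(ℝ, E) ∞ γ t) {p : M}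
    (hp : γ t ∈ (extChartAt 𝓘(ℝ, E) p).source) : ContDiffAt ℝ ∞ (chartLift (E := E) p γ) t :=
  (contDiffAt_extChartAt_comp h hp).prodMk
    (contDiffAt_deriv_of_contDiffAt (contDiffAt_extChartAt_comp h hp))

lemma derivWithin_eventuallyEq_deriv {u : ℝ → E} {s : Set ℝ} {t : ℝ} (hs : s ∈ 𝓝 t) :
    derivWithin u s =ᶠ[𝓝 t] deriv u := by
  filter_upwards [eventually_mem_nhds_iff.2 hs] with τ hτ using derivWithin_of_mem_nhds hτ

lemma Metric.acceleration_eq {γ : ℝ → M} {s : Set ℝ} {t : ℝ} (hs : s ∈ 𝓝 t) (p : M) :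
    g.acceleration p γ s t = deriv (deriv fun τ ↦ extChartAt 𝓘(ℝ, E) p (γ τ)) t +
      g.christoffel p (chartLift p γ t).1 (chartLift p γ t).2 (chartLift p γ t).2 := by
  have h := derivWithin_eventuallyEq_deriv (u := fun τ ↦ extChartAt 𝓘(ℝ, E) p (γ τ)) hs
  simp only [Metric.acceleration, chartLift]
  rw [derivWithin_of_mem_nhds hs, h.deriv_eq, h.eq_of_nhds]

lemma Metric.IsGeodesicOn.isGeodesicAt {g : Metric E M} {γ : ℝ → M} {s : Set ℝ} {t : ℝ}
    (h : g.IsGeodesicOn γ s) (hs : s ∈ 𝓝 t) : g.IsGeodesicAt γ t :=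
  ⟨h.1.contMDiffAt hs, fun p hp ↦ by
    rw [← g.acceleration_eq hs]; exact h.2 t (mem_of_mem_nhds hs) p hp⟩

lemma Metric.IsGeodesicAt.congr {g : Metric E M} {γ₁ γ₂ : ℝ → M} {t : ℝ}
    (h : g.IsGeodesicAt γ₁ t) (h' : γ₂ =ᶠ[𝓝 t] γ₁) : g.IsGeodesicAt γ₂ t := by
  refine ⟨h.1.congr_of_eventuallyEq h', fun p hp ↦ ?_⟩
  rw [chartLift_congr h', (extChartAt_comp_eventuallyEq h' p).deriv.deriv_eq]
  exact h.2 p (by rwa [← h'.eq_of_nhds])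

lemma Metric.IsGeodesicAt.hasDerivAt_chartLift {g : Metric E M} {γ : ℝ → M} {t : ℝ}
    (h : g.IsGeodesicAt γ t) {p : M} (hp : γ t ∈ (extChartAt 𝓘(ℝ, E) p).source) :
    HasDerivAt (chartLift p γ) (g.spray p (chartLift p γ t)) t := by
  have hu := contDiffAt_extChartAt_comp h.1 hp
  have h1 := (hu.differentiableAt (by simp)).hasDerivAt
  have h2 := ((contDiffAt_deriv_of_contDiffAt hu).differentiableAt (by simp)).hasDerivAt
  rw [eq_neg_of_add_eq_zero_left (h.2 p hp)] at h2
  exact h1.prodMk h2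

variable [FiniteDimensional ℝ E]

/-- The geodesic equation is independent of the chart: in `(ψ ∘ u)'' = D²ψ(u', u') + Dψ u''`, the
second-order term is exactly the defect in the transformation law of the Christoffel symbols. -/
lemma Metric.isGeodesicAt_of_chart {γ : ℝ → M} {t : ℝ}
    (h : ContMDiffAt 𝓘(ℝ, ℝ) 𝓘(ℝ, E) ∞ γ t) {p : M}
    (hp : γ t ∈ (extChartAt 𝓘(ℝ, E) p).source)
    (hγ : deriv (deriv fun τ ↦ extChartAt 𝓘(ℝ, E) p (γ τ)) t +
      g.christoffel p (chartLift p γ t).1 (chartLift p γ t).2 (chartLift p γ t).2 = 0) :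
    g.IsGeodesicAt γ t := by
  refine ⟨h, fun q hq ↦ ?_⟩
  set u := fun τ ↦ extChartAt 𝓘(ℝ, E) p (γ τ) with hu
  have hsm := contDiffAt_extChartAt_comp h hp
  have hty : u t ∈ (extChartAt 𝓘(ℝ, E) p).target := (extChartAt 𝓘(ℝ, E) p).map_source hp
  have hq' : (extChartAt 𝓘(ℝ, E) p).symm (u t) ∈ (extChartAt 𝓘(ℝ, E) q).source := by
    rwa [hu, (extChartAt 𝓘(ℝ, E) p).left_inv hp]
  have hψ := contDiffAt_chartChange hty hq'
  have heq : (fun τ ↦ extChartAt 𝓘(ℝ, E) q (γ τ)) =ᶠ[𝓝 t] fun τ ↦ chartChange p q (u τ) := by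
    filter_upwards [h.continuousAt.eventually (extChartAt_source_mem_nhds_of_mem hp)] with τ hτ
    simp only [chartChange, hu]
    rw [(extChartAt 𝓘(ℝ, E) p).left_inv hτ]
  have hsm' : ∀ᶠ τ in 𝓝 t, ContDiffAt ℝ 1 u τ :=
    (hsm.of_le (m := 1) (by simp)).eventually (by simp)
  have hd : ∀ᶠ τ in 𝓝 t, HasDerivAt u (deriv u τ) τ := by
    filter_upwards [hsm'] with τ hτ using (hτ.differentiableAt (by simp)).hasDerivAt
  have hev := hsm.continuousAt.eventually (eventually_mem_target_and_symm_mem_source hty hq')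
  have heq' : deriv (fun τ ↦ extChartAt 𝓘(ℝ, E) q (γ τ)) =ᶠ[𝓝 t]
      fun τ ↦ fderiv ℝ (chartChange (E := E) p q) (u τ) (deriv u τ) := by
    refine heq.deriv.trans ?_
    filter_upwards [hd, hev] with τ h1 h2
    exact (hasDerivAt_comp_of_contDiffAt (contDiffAt_chartChange h2.1 h2.2) h1).deriv
  have h2 := ((contDiffAt_deriv_of_contDiffAt hsm).differentiableAt (by simp)).hasDerivAt
  have h1 : HasDerivAt (fun τ ↦ fderiv ℝ (chartChange (E := E) p q) (u τ))
      (fderiv ℝ (fderiv ℝ (chartChange (E := E) p q)) (u t) (deriv u t)) t :=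
    hasDerivAt_comp_of_contDiffAt (hψ.fderiv_right (m := ∞) (by simp)) hd.self_of_nhds
  have h3 := h1.clm_apply h2
  have hlift : chartLift (E := E) q γ t = (chartChange p q (u t),
      fderiv ℝ (chartChange (E := E) p q) (u t) (deriv u t)) :=
    Prod.ext heq.eq_of_nhds heq'.eq_of_nhds
  rw [heq'.deriv_eq, h3.deriv, hlift, eq_neg_of_add_eq_zero_left hγ, map_neg]
  simp only [chartLift]
  rw [g.fderiv_chartChange_christoffel hty hq']
  abel

/-- A solution of the geodesic equation in a chart is a geodesic. -/
lemma Metric.isGeodesicAt_of_hasDerivAt_spray {p : M} {z : ℝ → E × E} {t : ℝ}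
    (hz : ∀ᶠ τ in 𝓝 t, HasDerivAt z (g.spray p (z τ)) τ ∧
      (z τ).1 ∈ (extChartAt 𝓘(ℝ, E) p).target) :
    g.IsGeodesicAt (fun τ ↦ (extChartAt 𝓘(ℝ, E) p).symm (z τ).1) t ∧
      chartLift p (fun τ ↦ (extChartAt 𝓘(ℝ, E) p).symm (z τ).1) =ᶠ[𝓝 t] z := by
  have hsm : ContDiffAt ℝ ∞ z t := by
    refine contDiffAt_of_hasDerivAt_ode (F := g.spray p)
      (U := (extChartAt 𝓘(ℝ, E) p).target ×ˢ univ)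
      (fun x hx ↦ (g.contDiffAt_spray hx.1).contDiffWithinAt) ?_
    filter_upwards [hz] with τ hτ using ⟨hτ.1, hτ.2, mem_univ _⟩
  have hmem := hz.self_of_nhds.2
  have h1 : ∀ᶠ τ in 𝓝 t,
      extChartAt 𝓘(ℝ, E) p ((extChartAt 𝓘(ℝ, E) p).symm (z τ).1) = (z τ).1 := by
    filter_upwards [hz] with τ hτ using (extChartAt 𝓘(ℝ, E) p).right_inv hτ.2
  have h2 : deriv (fun τ ↦ extChartAt 𝓘(ℝ, E) p ((extChartAt 𝓘(ℝ, E) p).symm (z τ).1)) =ᶠ[𝓝 t]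
      fun τ ↦ (z τ).2 := by
    refine (Filter.EventuallyEq.deriv h1).trans ?_
    filter_upwards [hz] with τ hτ
    exact (hasFDerivAt_fst.comp_hasDerivAt τ hτ.1).deriv
  have hlift : chartLift p (fun τ ↦ (extChartAt 𝓘(ℝ, E) p).symm (z τ).1) =ᶠ[𝓝 t] z := by
    filter_upwards [h1, h2] with τ h1 h2 using Prod.ext h1 h2
  refine ⟨g.isGeodesicAt_of_chart (p := p) ?_ ((extChartAt 𝓘(ℝ, E) p).map_target hmem) ?_, hlift⟩
  · exact (contMDiffAt_extChartAt_symm_of_mem hmem).comp t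
      (contDiffAt_fst.comp t hsm).contMDiffAt
  · have h3 : HasDerivAt (fun τ ↦ (z τ).2) (g.spray p (z t)).2 t :=
      (hasFDerivAt_snd (𝕜 := ℝ) (E := E) (F := E) (p := z t)).comp_hasDerivAt t
        hz.self_of_nhds.1
    rw [h2.deriv_eq, hlift.eq_of_nhds, h3.deriv]
    simp [Metric.spray]

/-- Both lifts solve the spray equation, whose right-hand side is locally Lipschitz, with the same
value at `t`. -/
lemma Metric.eventuallyEq_of_isGeodesicAt {γ₁ γ₂ : ℝ → M} {t : ℝ}
    (h₁ : ∀ᶠ τ in 𝓝 t, g.IsGeodesicAt γ₁ τ) (h₂ : ∀ᶠ τ in 𝓝 t, g.IsGeodesicAt γ₂ τ) {p : M}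
    (hp₁ : γ₁ t ∈ (extChartAt 𝓘(ℝ, E) p).source) (hp₂ : γ₂ t ∈ (extChartAt 𝓘(ℝ, E) p).source)
    (h : chartLift (E := E) p γ₁ t = chartLift p γ₂ t) : γ₁ =ᶠ[𝓝 t] γ₂ := by
  have hz : (chartLift (E := E) p γ₁ t).1 ∈ (extChartAt 𝓘(ℝ, E) p).target :=
    (extChartAt 𝓘(ℝ, E) p).map_source hp₁
  obtain ⟨K, U, hU, hK⟩ := ((g.contDiffAt_spray hz).of_le (m := 1) (by simp)).exists_lipschitzOnWith
  have key : ∀ γ : ℝ → M, (∀ᶠ τ in 𝓝 t, g.IsGeodesicAt γ τ) →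
      γ t ∈ (extChartAt 𝓘(ℝ, E) p).source → U ∈ 𝓝 (chartLift (E := E) p γ t) →
      ∀ᶠ τ in 𝓝 t, (HasDerivAt (chartLift p γ) (g.spray p (chartLift p γ τ)) τ ∧
        chartLift p γ τ ∈ U) ∧ γ τ ∈ (extChartAt 𝓘(ℝ, E) p).source := by
    intro γ hγ hp hU
    have hc : ContinuousAt γ t := hγ.self_of_nhds.1.continuousAt
    filter_upwards [hγ, hc.eventually (extChartAt_source_mem_nhds_of_mem hp),
      (contDiffAt_chartLift hγ.self_of_nhds.1 hp).continuousAt.eventually hU] with τ h1 h2 h3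
    exact ⟨⟨h1.hasDerivAt_chartLift h2, h3⟩, h2⟩
  have k1 := key γ₁ h₁ hp₁ hU
  have k2 := key γ₂ h₂ hp₂ (by rwa [← h])
  have := ODE_solution_unique_of_eventually (v := fun _ ↦ g.spray p) (s := fun _ ↦ U) (K := K)
    (Eventually.of_forall fun _ ↦ hK) (k1.mono fun _ h ↦ h.1) (k2.mono fun _ h ↦ h.1) h
  filter_upwards [this, k1, k2] with τ h h1 h2
  exact (extChartAt 𝓘(ℝ, E) p).injOn h1.2 h2.2 (congrArg Prod.fst h)

/-- Two geodesics which have the same velocity at some time coincide. -/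
theorem Metric.eqOn_of_isGeodesicAt [T2Space M] {γ₁ γ₂ : ℝ → M} {s : Set ℝ} (hs : IsOpen s)
    (hs' : IsPreconnected s) (h₁ : ∀ t ∈ s, g.IsGeodesicAt γ₁ t)
    (h₂ : ∀ t ∈ s, g.IsGeodesicAt γ₂ t) {t₀ : ℝ} (ht₀ : t₀ ∈ s) {p : M}
    (hp₁ : γ₁ t₀ ∈ (extChartAt 𝓘(ℝ, E) p).source) (hp₂ : γ₂ t₀ ∈ (extChartAt 𝓘(ℝ, E) p).source)
    (h : chartLift (E := E) p γ₁ t₀ = chartLift p γ₂ t₀) : EqOn γ₁ γ₂ s := by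
  have hev : ∀ t ∈ s, (∀ᶠ τ in 𝓝 t, g.IsGeodesicAt γ₁ τ) ∧ ∀ᶠ τ in 𝓝 t, g.IsGeodesicAt γ₂ τ :=
    fun t ht ↦ ⟨eventually_of_mem (hs.mem_nhds ht) h₁, eventually_of_mem (hs.mem_nhds ht) h₂⟩
  have hopen : IsOpen {t | γ₁ =ᶠ[𝓝 t] γ₂} := by
    rw [isOpen_iff_mem_nhds]
    intro t ht
    exact eventually_eventuallyEq_nhds.2 ht
  -- Connectedness argument: the set of times near which the curves agree is open, meets `s`, and is
  -- shown to be relatively closed in `s`.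
  have hsub := hs'.subset_of_closure_inter_subset hopen
    ⟨t₀, ht₀, g.eventuallyEq_of_isGeodesicAt (hev t₀ ht₀).1 (hev t₀ ht₀).2 hp₁ hp₂ h⟩ ?_
  · exact fun t ht ↦ (hsub ht).eq_of_nhds
  rintro t ⟨htc, ht⟩
  have hfreq : ∃ᶠ τ in 𝓝 t, γ₁ =ᶠ[𝓝 τ] γ₂ := mem_closure_iff_frequently.1 htc
  have heq : γ₁ t = γ₂ t := by
    by_contra hne
    have := ((h₁ t ht).1.continuousAt.ne_iff_eventually_ne (h₂ t ht).1.continuousAt).1 hne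
    obtain ⟨τ, h1, h2⟩ := (hfreq.and_eventually this).exists
    exact h2 h1.eq_of_nhds
  have hp₁ : γ₁ t ∈ (extChartAt 𝓘(ℝ, E) (γ₁ t)).source := mem_extChartAt_source _
  have hp₂ : γ₂ t ∈ (extChartAt 𝓘(ℝ, E) (γ₁ t)).source := by rw [← heq]; exact hp₁
  refine g.eventuallyEq_of_isGeodesicAt (hev t ht).1 (hev t ht).2 hp₁ hp₂ ?_
  -- Lifts distinct at `t` would remain distinct nearby, but the curves, hence their lifts, agree
  -- near times arbitrarily close to `t`.
  by_contra hne
  have := ((contDiffAt_chartLift (h₁ t ht).1 hp₁).continuousAt.ne_iff_eventually_ne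
    (contDiffAt_chartLift (h₂ t ht).1 hp₂).continuousAt).1 hne
  obtain ⟨τ, h1, h2⟩ := (hfreq.and_eventually this).exists
  exact h2 (chartLift_congr h1 _)

end Geodesic

/-! ### Extending a geodesic when its velocities converge -/

section Extension

variable {E : Type*} [NormedAddCommGroup E] [NormedSpace ℝ E]

lemma derivWithin_congr_eventually {u u' : ℝ → E} {s s' : Set ℝ} {t : ℝ} (hu : u =ᶠ[𝓝 t] u')
    (hs : s =ᶠ[𝓝 t] s') : derivWithin u s =ᶠ[𝓝 t] derivWithin u' s' := by
  filter_upwards [eventually_eventually_nhds.2 hu, eventually_eventually_nhds.2 hs] with τ h1 h2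
  rw [derivWithin_congr_set h2]
  exact Filter.EventuallyEq.derivWithin_eq (h1.filter_mono nhdsWithin_le_nhds) h1.self_of_nhds

variable {M : Type*} [TopologicalSpace M] [ChartedSpace E M] [IsManifold 𝓘(ℝ, E) ∞ M]
  (g : Metric E M)

lemma Metric.acceleration_congr {γ γ' : ℝ → M} {s s' : Set ℝ} {t : ℝ} (hγ : γ =ᶠ[𝓝 t] γ')
    (hs : s =ᶠ[𝓝 t] s') (p : M) : g.acceleration p γ s t = g.acceleration p γ' s' t := by
  have h1 := derivWithin_congr_eventually (extChartAt_comp_eventuallyEq (E := E) hγ p) hs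
  have h2 := derivWithin_congr_eventually h1 hs
  simp only [Metric.acceleration]
  rw [h1.eq_of_nhds, h2.eq_of_nhds, hγ.eq_of_nhds]

lemma Metric.IsGeodesicAt.acceleration_eq_zero {g : Metric E M} {γ : ℝ → M} {s : Set ℝ} {t : ℝ}
    (h : g.IsGeodesicAt γ t) (hs : s ∈ 𝓝 t) {p : M}
    (hp : γ t ∈ (extChartAt 𝓘(ℝ, E) p).source) : g.acceleration p γ s t = 0 := by
  rw [g.acceleration_eq hs]; exact h.2 p hp

lemma Ico_eventuallyEq_of_lt {a b b' t : ℝ} (h : t < b) (h' : t < b') :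
    (Ico a b : Set ℝ) =ᶠ[𝓝 t] Ico a b' := by
  filter_upwards [Iio_mem_nhds h, Iio_mem_nhds h'] with τ h1 h2
  exact propext ⟨fun h ↦ ⟨h.1, h2⟩, fun h ↦ ⟨h.1, h1⟩⟩

/-- Being a geodesic is local, so only the junction matters; there `σ` is assumed to be a geodesic
on both sides of `b`. -/
lemma Metric.isGeodesicOn_Ico_of_glue {γ σ : ℝ → M} {a b b' : ℝ}
    (hγ : g.IsGeodesicOn γ (Ico a b)) (hσγ : EqOn σ γ (Iio b))
    (hσ : ∀ t ∈ Ico b b', g.IsGeodesicAt σ t) (hab : a < b) : g.IsGeodesicOn σ (Ico a b') := by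
  have hev : ∀ t < b, σ =ᶠ[𝓝 t] γ := fun t ht ↦ eventually_of_mem (Iio_mem_nhds ht) hσγ
  have hn : ∀ t ∈ Ico b b', Ico a b' ∈ 𝓝 t := fun t ht ↦
    Ico_mem_nhds (hab.trans_le ht.1) ht.2
  refine ⟨fun t ht ↦ ?_, fun t ht p hp ↦ ?_⟩
  · rcases lt_or_ge t b with h | h
    · have h1 : ContMDiffWithinAt 𝓘(ℝ, ℝ) 𝓘(ℝ, E) ∞ γ (Ico a b') t :=
        (hγ.1 t ⟨ht.1, h⟩).congr_set (Ico_eventuallyEq_of_lt h ht.2)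
      exact h1.congr_of_eventuallyEq ((hev t h).filter_mono nhdsWithin_le_nhds)
        (hev t h).eq_of_nhds
    · exact (hσ t ⟨h, ht.2⟩).1.contMDiffWithinAt
  · rcases lt_or_ge t b with h | h
    · rw [g.acceleration_congr (hev t h) (Ico_eventuallyEq_of_lt ht.2 h)]
      exact hγ.2 t ⟨ht.1, h⟩ p (by rwa [← (hev t h).eq_of_nhds])
    · exact (hσ t ⟨h, ht.2⟩).acceleration_eq_zero (hn t ⟨h, ht.2⟩) hp

/-- The local flow of the geodesic equation in the chart at `p`. -/
lemma Metric.exists_geodesic_flow [FiniteDimensional ℝ E] {p : M} {z₀ : E × E}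
    (hz₀ : z₀.1 ∈ (extChartAt 𝓘(ℝ, E) p).target) :
    ∃ r > 0, ∃ ε > 0, ∃ α : E × E → ℝ → E × E,
      (∀ z ∈ Metric.closedBall z₀ r, α z 0 = z ∧ ∀ t₀ : ℝ, ∃ β : ℝ → M,
        ∀ t ∈ Ioo (t₀ - ε) (t₀ + ε), g.IsGeodesicAt β t ∧
          β t ∈ (extChartAt 𝓘(ℝ, E) p).source ∧ chartLift p β t = α z (t - t₀)) ∧
      ContinuousOn (Function.uncurry α) (Metric.closedBall z₀ r ×ˢ Icc (-ε) ε) := by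
  have hU : (extChartAt 𝓘(ℝ, E) p).target ×ˢ (univ : Set E) ∈ 𝓝 z₀ :=
    ((isOpen_extChartAt_target p).prod isOpen_univ).mem_nhds ⟨hz₀, mem_univ _⟩
  obtain ⟨r, hr, ε, hε, α, -, hα, hcont, -⟩ := exists_local_flow
    ((g.contDiffAt_spray hz₀).of_le (m := 1) (by simp)) hU
  refine ⟨r, hr, ε, hε, α, fun z hz ↦ ⟨(hα z hz).1, fun t₀ ↦
    ⟨fun τ ↦ (extChartAt 𝓘(ℝ, E) p).symm (α z (τ - t₀)).1, fun t ht ↦ ?_⟩⟩, hcont⟩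
  have key : ∀ᶠ τ in 𝓝 t, HasDerivAt (fun τ ↦ α z (τ - t₀)) (g.spray p (α z (τ - t₀))) τ ∧
      (α z (τ - t₀)).1 ∈ (extChartAt 𝓘(ℝ, E) p).target := by
    filter_upwards [Ioo_mem_nhds ht.1 ht.2] with τ hτ
    have h := (hα z hz).2 (τ - t₀) ⟨by linarith [hτ.1], by linarith [hτ.2]⟩
    exact ⟨HasDerivAt.comp_sub_const τ t₀ h.1, h.2.1⟩
  exact ⟨(g.isGeodesicAt_of_hasDerivAt_spray key).1,
    (extChartAt 𝓘(ℝ, E) p).map_target key.self_of_nhds.2,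
    (g.isGeodesicAt_of_hasDerivAt_spray key).2.eq_of_nhds⟩

/-- The existence time `ε` is uniform near `z₀`, so a geodesic `β` launched with the velocity of `γ`
at a late time `s n > b - ε` survives past `b`. Uniqueness identifies it with `γ` before `b`. -/
theorem Metric.isExtendibleBeyond_of_tendsto_chartLift [FiniteDimensional ℝ E] [T2Space M]
    {γ : ℝ → M} {b : ℝ} (hγ : g.IsGeodesicOn γ (Ico 0 b)) {p : M} {z₀ : E × E}
    (hz₀ : z₀.1 ∈ (extChartAt 𝓘(ℝ, E) p).target) {s : ℕ → ℝ} (hs : ∀ᶠ n in atTop, s n ∈ Ioo 0 b)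
    (hsb : Tendsto s atTop (𝓝 b))
    (hsp : ∀ᶠ n in atTop, γ (s n) ∈ (extChartAt 𝓘(ℝ, E) p).source)
    (hlim : Tendsto (fun n ↦ chartLift p γ (s n)) atTop (𝓝 z₀)) :
    g.IsExtendibleBeyond γ b := by
  obtain ⟨r, hr, ε, hε, α, hloc, -⟩ := g.exists_geodesic_flow hz₀
  obtain ⟨n, hn1, hn2, hn3, hn4⟩ := (hs.and (hsp.and ((hlim.eventually
    (Metric.closedBall_mem_nhds z₀ hr)).and (hsb.eventually
      (Ioi_mem_nhds (show b - ε < b by linarith)))))).exists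
  obtain ⟨hα0, hβ⟩ := hloc _ hn3
  obtain ⟨β, hβ⟩ := hβ (s n)
  have hsn : s n ∈ Ioo (s n - ε) (s n + ε) := ⟨by linarith, by linarith⟩
  have hbε : b < s n + ε := by have : b - ε < s n := hn4; linarith
  have hEq : EqOn γ β (Ioo (max 0 (s n - ε)) b) := by
    refine g.eqOn_of_isGeodesicAt isOpen_Ioo isPreconnected_Ioo (fun t ht ↦ ?_) (fun t ht ↦ ?_)
      (t₀ := s n) ⟨max_lt hn1.1 (by linarith), hn1.2⟩ hn2
      (hβ _ hsn).2.1 (by rw [(hβ _ hsn).2.2, sub_self, hα0])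
    · exact hγ.isGeodesicAt (Ico_mem_nhds ((le_max_left _ _).trans_lt ht.1) ht.2)
    · exact (hβ t ⟨(le_max_right _ _).trans_lt ht.1, ht.2.trans hbε⟩).1
  refine ⟨s n + ε, hbε, fun t ↦ if t < b then γ t else β t, ?_, fun t ht ↦ if_pos ht.2⟩
  refine g.isGeodesicOn_Ico_of_glue hγ (fun t ht ↦ if_pos ht) (fun t ht ↦ ?_)
    (hn1.1.trans hn1.2)
  refine (hβ t ⟨by linarith [ht.1, hn1.2], ht.2⟩).1.congr ?_
  have hlt : max 0 (s n - ε) < t :=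
    max_lt (by linarith [ht.1, hn1.1, hn1.2]) (by linarith [ht.1, hn1.2])
  filter_upwards [Ioi_mem_nhds hlt] with τ hτ
  by_cases h : τ < b
  · rw [if_pos h, hEq ⟨hτ, h⟩]
  · rw [if_neg h]

lemma mfderiv_extChartAt_velocity {γ : ℝ → M} {s : Set ℝ} {t : ℝ} (hs : s ∈ 𝓝 t)
    (hγ : ContMDiffOn 𝓘(ℝ, ℝ) 𝓘(ℝ, E) ∞ γ s) {p : M}
    (hp : γ t ∈ (extChartAt 𝓘(ℝ, E) p).source) :
    mfderiv 𝓘(ℝ, E) 𝓘(ℝ, E) (extChartAt 𝓘(ℝ, E) p) (γ t) (velocity γ s t) =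
      (chartLift (E := E) p γ t).2 := by
  have h1 : MDifferentiableAt 𝓘(ℝ, ℝ) 𝓘(ℝ, E) γ t :=
    (hγ.contMDiffAt hs).mdifferentiableAt (by simp)
  have h2 : MDifferentiableAt 𝓘(ℝ, E) 𝓘(ℝ, E) (extChartAt 𝓘(ℝ, E) p) (γ t) :=
    (contMDiffAt_extChartAt_of_mem hp).mdifferentiableAt (by simp)
  have h3 := mfderiv_comp t h2 h1
  rw [mfderiv_eq_fderiv] at h3
  rw [velocity, mfderivWithin_of_mem_nhds hs]
  exact (congrArg (fun L : ℝ →L[ℝ] E ↦ L 1) h3).symm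

/-- The trivialization of the tangent bundle at `v.1` is the derivative of the chart there, so
convergence in the bundle is convergence of position and velocity in coordinates. -/
lemma tendsto_chartLift_of_tendsto_velocity {γ : ℝ → M} {S : Set ℝ}
    (hγ : ContMDiffOn 𝓘(ℝ, ℝ) 𝓘(ℝ, E) ∞ γ S) {s : ℕ → ℝ} (hs : ∀ᶠ n in atTop, S ∈ 𝓝 (s n))
    {v : TangentBundle 𝓘(ℝ, E) M}
    (hv : Tendsto (fun n ↦ (⟨γ (s n), velocity γ S (s n)⟩ : TangentBundle 𝓘(ℝ, E) M))
      atTop (𝓝 v)) :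
    (∀ᶠ n in atTop, γ (s n) ∈ (extChartAt 𝓘(ℝ, E) v.1).source) ∧
    Tendsto (fun n ↦ chartLift v.1 γ (s n)) atTop
      (𝓝 (extChartAt 𝓘(ℝ, E) v.1 v.1,
        (trivializationAt E (TangentSpace 𝓘(ℝ, E)) v.1 v).2)) := by
  have hproj : Tendsto (fun n ↦ γ (s n)) atTop (𝓝 v.1) :=
    ((FiberBundle.continuous_proj E (TangentSpace 𝓘(ℝ, E) (M := M))).tendsto v).comp hv
  have hsrc : ∀ᶠ n in atTop, γ (s n) ∈ (extChartAt 𝓘(ℝ, E) v.1).source :=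
    hproj.eventually (extChartAt_source_mem_nhds_of_mem (mem_extChartAt_source _))
  refine ⟨hsrc, Tendsto.prodMk_nhds ?_ ?_⟩
  · exact (continuousAt_extChartAt v.1).tendsto.comp hproj
  · have hc : ContinuousAt (trivializationAt E (TangentSpace 𝓘(ℝ, E)) v.1) v :=
      (trivializationAt E (TangentSpace 𝓘(ℝ, E)) v.1).continuousAt
        (FiberBundle.mem_trivializationAt_proj_source)
    have h2 := (continuous_snd.tendsto _).comp (hc.tendsto.comp hv)
    refine h2.congr' ?_
    filter_upwards [hsrc, hs] with n hn hsn
    have hn' : γ (s n) ∈ (chartAt E v.1).source := by simpa using hn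
    have hb : γ (s n) ∈ (trivializationAt E (TangentSpace 𝓘(ℝ, E)) v.1).baseSet := by
      simpa using hn'
    have h3 := mfderiv_extChartAt_velocity hsn hγ hn
    rw [← TangentBundle.continuousLinearMapAt_trivializationAt hn'] at h3
    have h4 := (trivializationAt E (TangentSpace 𝓘(ℝ, E)) v.1).continuousLinearMapAt_apply_of_mem
      (R := ℝ) hb (velocity γ S (s n))
    exact h4.symm.trans h3

theorem Metric.isExtendibleBeyond_of_tendsto_velocity [FiniteDimensional ℝ E] [T2Space M]
    {γ : ℝ → M} {b : ℝ} (hγ : g.IsGeodesicOn γ (Ico 0 b)) {s : ℕ → ℝ}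
    (hs : ∀ᶠ n in atTop, s n ∈ Ioo 0 b)
    (hsb : Tendsto s atTop (𝓝 b)) {v : TangentBundle 𝓘(ℝ, E) M}
    (hv : Tendsto (fun n ↦ (⟨γ (s n), velocity γ (Ico 0 b) (s n)⟩ : TangentBundle 𝓘(ℝ, E) M))
      atTop (𝓝 v)) : g.IsExtendibleBeyond γ b := by
  obtain ⟨h1, h2⟩ := tendsto_chartLift_of_tendsto_velocity hγ.1
    (hs.mono fun n hn ↦ Ico_mem_nhds hn.1 hn.2) hv
  exact g.isExtendibleBeyond_of_tendsto_chartLift hγ (mem_extChartAt_target _) hs hsb h1 h2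

end Extension

/-! ### Short-time shooting for second-order equations -/

section SecondOrder

variable {E : Type*} [NormedAddCommGroup E] [NormedSpace ℝ E]

lemma norm_sub_le_of_hasDerivAt {u u' : ℝ → E} {C s : ℝ}
    (h : ∀ t ∈ Icc (-|s|) |s|, HasDerivAt u (u' t) t) (hC : ∀ t ∈ Icc (-|s|) |s|, ‖u' t‖ ≤ C)
    {t : ℝ} (ht : t ∈ Icc (-|s|) |s|) : ‖u t - u 0‖ ≤ C * |s| := by
  have h0 : (0 : ℝ) ∈ Icc (-|s|) |s| := ⟨by simp, abs_nonneg s⟩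
  have h1 := (convex_Icc (-|s|) |s|).norm_image_sub_le_of_norm_hasDerivWithin_le
    (fun x hx ↦ (h x hx).hasDerivWithinAt) hC h0 ht
  refine h1.trans ?_
  have : 0 ≤ C := (norm_nonneg _).trans (hC 0 h0)
  have h2 : ‖t - 0‖ ≤ |s| := by rw [sub_zero, Real.norm_eq_abs]; exact abs_le.2 ht
  gcongr

/-- For a second order equation with the equilibrium `(y₀, 0)`, the solutions starting from `y₀`
reach at a given small time all the points near `y₀`. -/
lemma exists_solution_through [CompleteSpace E] {f : E × E → E} {y₀ : E}
    (hf : ContDiffAt ℝ 1 (fun z : E × E ↦ (z.2, f z)) (y₀, 0)) (h0 : f (y₀, 0) = 0)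
    {U : Set (E × E)} (hU : U ∈ 𝓝 (y₀, (0 : E))) :
    ∃ ε > 0, ∀ s : ℝ, s ≠ 0 → |s| < ε → ∃ V ∈ 𝓝 y₀, ∀ y ∈ V, ∃ z : ℝ → E × E,
      (∀ t ∈ Icc (-ε) ε, HasDerivAt z ((z t).2, f (z t)) t ∧ z t ∈ U) ∧
      (z 0).1 = y₀ ∧ (z s).1 = y := by
  obtain ⟨K, U', hU', hK⟩ := hf.exists_lipschitzOnWith
  obtain ⟨r, hr, ε, hε, α, L, hα, -, hL⟩ := exists_local_flow hf (inter_mem hU hU')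
  have hKL : 0 < (K : ℝ) * L + 1 := by positivity
  -- This bound on `|s|` makes `K * L * |s| ≤ 1 / 2`, the approximation constant used in `happ`.
  refine ⟨min ε (1 / (2 * (K * L + 1))), by positivity, fun s hs hsε ↦ ?_⟩
  have hsε1 : |s| < ε := hsε.trans_le (min_le_left _ _)
  have hsε2 : (K * L + 1) * |s| ≤ 1 / 2 := by
    have := (hsε.trans_le (min_le_right _ _)).le
    calc (K * L + 1) * |s| ≤ (K * L + 1) * (1 / (2 * (K * L + 1))) := by gcongr
      _ = 1 / 2 := by field_simp
  have hspos : 0 < |s| := abs_pos.2 hs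
  have hIs : Icc (-|s|) |s| ⊆ Icc (-ε) ε := Icc_subset_Icc (by linarith) hsε1.le
  have hball : ∀ v ∈ Metric.closedBall (0 : E) r, (y₀, v) ∈ Metric.closedBall (y₀, (0 : E)) r := by
    intro v hv
    simpa [Prod.dist_eq, hr.le] using hv
  have hsmem : s ∈ Icc (-|s|) |s| := ⟨neg_abs_le s, le_abs_self s⟩
  -- `K * L * ‖v - v'‖` bounds the difference of the accelerations. Integrating twice shows that, up
  -- to an error of order `s²`, the end point depends on `v` as `s • v` does.
  have key : ∀ v ∈ Metric.closedBall (0 : E) r, ∀ v' ∈ Metric.closedBall (0 : E) r,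
      ‖(α (y₀, v) s).1 - (α (y₀, v') s).1 - s • (v - v')‖ ≤ K * L * ‖v - v'‖ * |s| * |s| := by
    intro v hv v' hv'
    have hv1 := hα _ (hball v hv)
    have hv2 := hα _ (hball v' hv')
    have hd : ∀ t ∈ Icc (-|s|) |s|,
        ‖f (α (y₀, v) t) - f (α (y₀, v') t)‖ ≤ K * L * ‖v - v'‖ := by
      intro t ht
      have h1 := hK.norm_sub_le (hv1.2 t (hIs ht)).2.2 (hv2.2 t (hIs ht)).2.2
      have h2 := (hL t (hIs ht)).norm_sub_le (hball v hv) (hball v' hv')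
      have h3 : ‖(y₀, v) - (y₀, v')‖ = ‖v - v'‖ := by simp [Prod.norm_def]
      rw [h3] at h2
      calc _ ≤ _ := (le_max_right _ _).trans h1
        _ ≤ K * (L * ‖v - v'‖) := by gcongr
        _ = _ := by ring
    have hder1 : ∀ v ∈ Metric.closedBall (0 : E) r, ∀ t ∈ Icc (-|s|) |s|,
        HasDerivAt (fun t ↦ (α (y₀, v) t).1) (α (y₀, v) t).2 t := fun v hv t ht ↦
      (hasFDerivAt_fst (𝕜 := ℝ) (E := E) (F := E) (p := α (y₀, v) t)).comp_hasDerivAt t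
        ((hα _ (hball v hv)).2 t (hIs ht)).1
    have hder2 : ∀ v ∈ Metric.closedBall (0 : E) r, ∀ t ∈ Icc (-|s|) |s|,
        HasDerivAt (fun t ↦ (α (y₀, v) t).2) (f (α (y₀, v) t)) t := fun v hv t ht ↦
      (hasFDerivAt_snd (𝕜 := ℝ) (E := E) (F := E) (p := α (y₀, v) t)).comp_hasDerivAt t
        ((hα _ (hball v hv)).2 t (hIs ht)).1
    have hw : ∀ t ∈ Icc (-|s|) |s|,
        ‖(α (y₀, v) t).2 - (α (y₀, v') t).2 - (v - v')‖ ≤ K * L * ‖v - v'‖ * |s| := by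
      intro t ht
      have := norm_sub_le_of_hasDerivAt
        (u := fun t ↦ (α (y₀, v) t).2 - (α (y₀, v') t).2)
        (fun t ht ↦ (hder2 v hv t ht).sub (hder2 v' hv' t ht)) hd ht
      simpa [hv1.1, hv2.1] using this
    have := norm_sub_le_of_hasDerivAt
      (u := fun t ↦ (α (y₀, v) t).1 - (α (y₀, v') t).1 - t • (v - v'))
      (u' := fun t ↦ (α (y₀, v) t).2 - (α (y₀, v') t).2 - (v - v'))
      (fun t ht ↦ ((hder1 v hv t ht).sub (hder1 v' hv' t ht)).sub
        (by simpa using (hasDerivAt_id t).smul_const (v - v'))) hw hsmem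
    simpa [hv1.1, hv2.1] using this
  -- After division by `s`, the end-point map is within Lipschitz distance `1 / 2` of the identity,
  -- so the quantitative inverse function theorem gives surjectivity onto a ball.
  have happ : ApproximatesLinearOn (fun v ↦ s⁻¹ • (α (y₀, v) s).1) (ContinuousLinearMap.id ℝ E)
      (Metric.closedBall 0 r) (1 / 2) := by
    intro v hv v' hv'
    have h1 := key v hv v' hv'
    have h2 : s⁻¹ • (α (y₀, v) s).1 - s⁻¹ • (α (y₀, v') s).1 - ContinuousLinearMap.id ℝ E (v - v')
        = s⁻¹ • ((α (y₀, v) s).1 - (α (y₀, v') s).1 - s • (v - v')) := by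
      rw [smul_sub, smul_sub, smul_smul, inv_mul_cancel₀ hs, one_smul]; rfl
    rw [h2, norm_smul, norm_inv, Real.norm_eq_abs, inv_mul_le_iff₀ hspos]
    refine h1.trans ?_
    have h3 : (K : ℝ) * L * |s| ≤ 1 / 2 := by linarith [hsε2, hspos]
    have h4 : 0 ≤ ‖v - v'‖ * |s| := by positivity
    have h5 := mul_le_mul_of_nonneg_right h3 h4
    push_cast
    linarith
  let R : (ContinuousLinearMap.id ℝ E).NonlinearRightInverse :=
    { toFun := id, nnnorm := 1, bound' := by simp, right_inv' := by simp }
  have hsurj := happ.surjOn_closedBall_of_nonlinearRightInverse R hr.le Subset.rfl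
  -- The center of that ball is the end point for `v = 0`, which is `y₀` because `(y₀, 0)` is an
  -- equilibrium.
  have hz0 : (α (y₀, 0) s).1 = y₀ := by
    have hEq : EqOn (α (y₀, 0)) (fun _ ↦ (y₀, 0)) (Ioo (-ε) ε) := by
      have hb := hα _ (hball 0 (Metric.mem_closedBall_self hr.le))
      refine ODE_solution_unique_of_mem_Ioo (v := fun _ z ↦ (z.2, f z)) (s := fun _ ↦ U') (K := K)
        (t₀ := 0) (fun _ _ ↦ hK) ⟨by linarith, hε⟩ (fun t ht ↦ ?_) (fun t ht ↦ ?_) hb.1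
      · exact ⟨(hb.2 t (Ioo_subset_Icc_self ht)).1, (hb.2 t (Ioo_subset_Icc_self ht)).2.2⟩
      · refine ⟨?_, mem_of_mem_nhds hU'⟩
        simp only [h0]
        exact hasDerivAt_const t _
    rw [hEq (abs_lt.1 hsε1)]
  -- The rescaled image contains a ball of radius `(1 - 1 / 2) * r`; multiplying back by `s` gives
  -- this one.
  refine ⟨Metric.ball y₀ (|s| * (r / 2)), Metric.ball_mem_nhds _ (by positivity), fun y hy ↦ ?_⟩
  obtain ⟨v, hv, hvy⟩ : s⁻¹ • y ∈ (fun v ↦ s⁻¹ • (α (y₀, v) s).1) '' Metric.closedBall 0 r := by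
    refine hsurj ?_
    simp only [hz0, R]
    rw [Metric.mem_closedBall, dist_eq_norm, ← smul_sub, norm_smul, norm_inv, Real.norm_eq_abs,
      inv_mul_le_iff₀ hspos]
    have := (mem_ball_iff_norm.1 hy).le
    refine this.trans (le_of_eq ?_)
    push_cast
    ring
  have hvy' : (α (y₀, v) s).1 = y := by
    have := congrArg (fun w ↦ s • w) hvy
    simpa [smul_smul, hs] using this
  refine ⟨α (y₀, v), fun t ht ↦ ?_, by rw [(hα _ (hball v hv)).1], hvy'⟩
  have hmin : min ε (1 / (2 * (K * L + 1))) ≤ ε := min_le_left _ _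
  have := (hα _ (hball v hv)).2 t ⟨by linarith [ht.1], by linarith [ht.2]⟩
  exact ⟨this.1, this.2.1⟩

end SecondOrder

/-! ### Continuous dependence of geodesics on their initial velocity -/

section Dependence

variable {E : Type*} [NormedAddCommGroup E] [NormedSpace ℝ E]
  {M : Type*} [TopologicalSpace M] [ChartedSpace E M]

/-- The curves whose velocity at time `t`, read in the chart at `p`, is close to that of `σ`. -/
def liftNhds (p : M) (σ : ℝ → M) (t : ℝ) : Filter (ℝ → M) :=
  comap (fun σ' ↦ chartLift (E := E) p σ' t) (𝓝 (chartLift p σ t)) ⊓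
    𝓟 {σ' | σ' t ∈ (extChartAt 𝓘(ℝ, E) p).source}

variable [IsManifold 𝓘(ℝ, E) ∞ M] (g : Metric E M)

/-- The curves which are geodesics on a neighborhood of `[0, τ]`. -/
def Metric.geodesicSegments (τ : ℝ) : Set (ℝ → M) :=
  {σ | ∃ δ > 0, ∀ t ∈ Ioo (-δ) (τ + δ), g.IsGeodesicAt σ t}

lemma Metric.isGeodesicAt_of_mem_geodesicSegments {g : Metric E M} {τ t : ℝ} {σ : ℝ → M}
    (hσ : σ ∈ g.geodesicSegments τ) (ht : t ∈ Icc 0 τ) : g.IsGeodesicAt σ t := by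
  obtain ⟨δ, hδ, h⟩ := hσ
  exact h t ⟨by linarith [ht.1], by linarith [ht.2]⟩

lemma chartLift_eq_chartChange {γ : ℝ → M} {t : ℝ} (h : ContMDiffAt 𝓘(ℝ, ℝ) 𝓘(ℝ, E) ∞ γ t)
    {p q : M} (hp : γ t ∈ (extChartAt 𝓘(ℝ, E) p).source)
    (hq : γ t ∈ (extChartAt 𝓘(ℝ, E) q).source) :
    chartLift (E := E) q γ t = (chartChange p q (chartLift (E := E) p γ t).1,
      fderiv ℝ (chartChange (E := E) p q) (chartLift (E := E) p γ t).1 (chartLift p γ t).2) := by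
  have hty : (chartLift (E := E) p γ t).1 ∈ (extChartAt 𝓘(ℝ, E) p).target :=
    (extChartAt 𝓘(ℝ, E) p).map_source hp
  have hq' : (extChartAt 𝓘(ℝ, E) p).symm (chartLift (E := E) p γ t).1 ∈
      (extChartAt 𝓘(ℝ, E) q).source := by
    rwa [chartLift, (extChartAt 𝓘(ℝ, E) p).left_inv hp]
  have heq : (fun τ ↦ extChartAt 𝓘(ℝ, E) q (γ τ)) =ᶠ[𝓝 t]
      fun τ ↦ chartChange p q (extChartAt 𝓘(ℝ, E) p (γ τ)) := by
    filter_upwards [h.continuousAt.eventually (extChartAt_source_mem_nhds_of_mem hp)] with τ hτ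
    rw [chartChange, (extChartAt 𝓘(ℝ, E) p).left_inv hτ]
  have hd := ((contDiffAt_extChartAt_comp h hp).differentiableAt (by simp)).hasDerivAt
  exact Prod.ext heq.eq_of_nhds
    (heq.deriv_eq.trans (hasDerivAt_comp_of_contDiffAt (contDiffAt_chartChange hty hq') hd).deriv)

/-- Among geodesics, closeness of velocities does not depend on the chart, because `(y, v) ↦ (ψ y,
Dψ v)` is continuous. -/
lemma Metric.liftNhds_inf_le_of_mem_source {τ t : ℝ} (ht : t ∈ Icc 0 τ) {σ : ℝ → M}
    (hσ : σ ∈ g.geodesicSegments τ) {p q : M} (hp : σ t ∈ (extChartAt 𝓘(ℝ, E) p).source)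
    (hq : σ t ∈ (extChartAt 𝓘(ℝ, E) q).source) :
    liftNhds (E := E) p σ t ⊓ 𝓟 (g.geodesicSegments τ) ≤ liftNhds (E := E) q σ t := by
  set l := liftNhds (E := E) p σ t ⊓ 𝓟 (g.geodesicSegments τ) with hl
  have hlim : Tendsto (fun σ' ↦ chartLift (E := E) p σ' t) l (𝓝 (chartLift p σ t)) :=
    tendsto_comap.mono_left (inf_le_left.trans inf_le_left)
  have hsrc : ∀ᶠ σ' in l, σ' t ∈ (extChartAt 𝓘(ℝ, E) p).source :=
    Filter.Eventually.filter_mono (inf_le_left.trans inf_le_right) (eventually_principal.2 fun _ h ↦ h)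
  have hgeo : ∀ᶠ σ' in l, σ' ∈ g.geodesicSegments τ :=
    Filter.Eventually.filter_mono inf_le_right (eventually_principal.2 fun _ h ↦ h)
  have hty : (chartLift (E := E) p σ t).1 ∈ (extChartAt 𝓘(ℝ, E) p).target :=
    (extChartAt 𝓘(ℝ, E) p).map_source hp
  have hq' : (extChartAt 𝓘(ℝ, E) p).symm (chartLift (E := E) p σ t).1 ∈
      (extChartAt 𝓘(ℝ, E) q).source := by
    rwa [chartLift, (extChartAt 𝓘(ℝ, E) p).left_inv hp]
  have hsrcq : ∀ᶠ σ' in l, σ' t ∈ (extChartAt 𝓘(ℝ, E) q).source := by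
    have h1 := ((continuous_fst.tendsto _).comp hlim).eventually
      (eventually_mem_target_and_symm_mem_source hty hq')
    filter_upwards [h1, hsrc] with σ' h1 h2
    have h3 := h1.2
    simp only [Function.comp, chartLift] at h3
    rwa [(extChartAt 𝓘(ℝ, E) p).left_inv h2] at h3
  refine le_inf (tendsto_iff_comap.1 ?_) (le_principal_iff.2 hsrcq)
  rw [chartLift_eq_chartChange (isGeodesicAt_of_mem_geodesicSegments hσ ht).1 hp hq]
  have hψ := contDiffAt_chartChange hty hq'
  have h1 : Tendsto (fun σ' ↦ (chartChange p q (chartLift (E := E) p σ' t).1,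
      fderiv ℝ (chartChange (E := E) p q) (chartLift (E := E) p σ' t).1 (chartLift p σ' t).2)) l
      (𝓝 (chartChange p q (chartLift (E := E) p σ t).1,
      fderiv ℝ (chartChange (E := E) p q) (chartLift (E := E) p σ t).1 (chartLift p σ t).2)) := by
    have hT : ContDiffAt ℝ ∞ (fun z : E × E ↦ (chartChange p q z.1,
        fderiv ℝ (chartChange (E := E) p q) z.1 z.2)) (chartLift p σ t) :=
      (ContDiffAt.comp (g := chartChange p q) _ hψ contDiffAt_fst).prodMk
        (ContDiffAt.clm_apply (ContDiffAt.comp (g := fderiv ℝ (chartChange p q)) _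
          (hψ.fderiv_right (m := ∞) (by simp)) contDiffAt_fst) contDiffAt_snd)
    exact hT.continuousAt.tendsto.comp hlim
  refine h1.congr' ?_
  filter_upwards [hsrc, hsrcq, hgeo] with σ' h1 h2 h3
  exact (chartLift_eq_chartChange (isGeodesicAt_of_mem_geodesicSegments h3 ht).1 h1 h2).symm

variable [FiniteDimensional ℝ E] [T2Space M]

/-- By uniqueness the lift at `t₂` is the local flow applied to the lift at `t₁`, and the flow is
continuous. As `r` and `ε` do not depend on `σ`, `t₁` or `t₂`, times may be exchanged when
propagating along `σ`. -/
lemma Metric.exists_liftNhds_inf_le {p : M} {z₀ : E × E}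
    (hz₀ : z₀.1 ∈ (extChartAt 𝓘(ℝ, E) p).target) (τ : ℝ) :
    ∃ r > 0, ∃ ε > 0, ∀ t₁ ∈ Icc 0 τ, ∀ t₂ ∈ Icc 0 τ, |t₂ - t₁| < ε →
      ∀ σ ∈ g.geodesicSegments τ, σ t₁ ∈ (extChartAt 𝓘(ℝ, E) p).source →
      chartLift p σ t₁ ∈ Metric.ball z₀ r →
      liftNhds (E := E) p σ t₁ ⊓ 𝓟 (g.geodesicSegments τ) ≤ liftNhds (E := E) p σ t₂ := by
  obtain ⟨r, hr, ε, hε, α, hα, hcont⟩ := g.exists_geodesic_flow hz₀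
  refine ⟨r, hr, ε, hε, fun t₁ ht₁ t₂ ht₂ h12 σ hσ hσp hσz ↦ ?_⟩
  have h12' := abs_lt.1 h12
  have key : ∀ σ' ∈ g.geodesicSegments τ, σ' t₁ ∈ (extChartAt 𝓘(ℝ, E) p).source →
      chartLift p σ' t₁ ∈ Metric.ball z₀ r → σ' t₂ ∈ (extChartAt 𝓘(ℝ, E) p).source ∧
      chartLift p σ' t₂ = α (chartLift p σ' t₁) (t₂ - t₁) := by
    rintro σ' ⟨δ, hδ, hσ'⟩ hp hz
    obtain ⟨hα0, hβ⟩ := hα _ (Metric.ball_subset_closedBall hz)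
    obtain ⟨β, hβ⟩ := hβ t₁
    have hm1 : t₁ ∈ Ioo (t₁ - ε) (t₁ + ε) := ⟨by linarith, by linarith⟩
    have hm2 : t₂ ∈ Ioo (t₁ - ε) (t₁ + ε) := ⟨by linarith, by linarith⟩
    have hm1' : t₁ ∈ Ioo (-δ) (τ + δ) := ⟨by linarith [ht₁.1], by linarith [ht₁.2]⟩
    have hm2' : t₂ ∈ Ioo (-δ) (τ + δ) := ⟨by linarith [ht₂.1], by linarith [ht₂.2]⟩
    have hpc : IsPreconnected (Ioo (t₁ - ε) (t₁ + ε) ∩ Ioo (-δ) (τ + δ)) := by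
      rw [Ioo_inter_Ioo]; exact isPreconnected_Ioo
    have hopen : IsOpen (Ioo (t₁ - ε) (t₁ + ε) ∩ Ioo (-δ) (τ + δ)) := isOpen_Ioo.inter isOpen_Ioo
    have hEq := g.eqOn_of_isGeodesicAt hopen hpc (fun t ht ↦ hσ' t ht.2)
      (fun t ht ↦ (hβ t ht.1).1) ⟨hm1, hm1'⟩ hp (hβ t₁ hm1).2.1
      (by rw [(hβ t₁ hm1).2.2, sub_self, hα0])
    refine ⟨by rw [hEq ⟨hm2, hm2'⟩]; exact (hβ t₂ hm2).2.1, ?_⟩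
    rw [← (hβ t₂ hm2).2.2]
    exact chartLift_congr (eventually_of_mem (hopen.mem_nhds ⟨hm2, hm2'⟩) hEq) p
  set l := liftNhds (E := E) p σ t₁ ⊓ 𝓟 (g.geodesicSegments τ) with hl
  have hlim : Tendsto (fun σ' ↦ chartLift (E := E) p σ' t₁) l (𝓝 (chartLift p σ t₁)) :=
    tendsto_comap.mono_left (inf_le_left.trans inf_le_left)
  have hsrc : ∀ᶠ σ' in l, σ' t₁ ∈ (extChartAt 𝓘(ℝ, E) p).source :=
    Filter.Eventually.filter_mono (inf_le_left.trans inf_le_right) (eventually_principal.2 fun _ h ↦ h)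
  have hgeo : ∀ᶠ σ' in l, σ' ∈ g.geodesicSegments τ :=
    Filter.Eventually.filter_mono inf_le_right (eventually_principal.2 fun _ h ↦ h)
  have hkey : ∀ᶠ σ' in l, σ' t₂ ∈ (extChartAt 𝓘(ℝ, E) p).source ∧
      chartLift p σ' t₂ = α (chartLift p σ' t₁) (t₂ - t₁) := by
    filter_upwards [hsrc, hgeo, hlim.eventually (Metric.isOpen_ball.mem_nhds hσz)]
      with σ' h1 h2 h3 using key σ' h2 h1 h3
  refine le_inf (tendsto_iff_comap.1 ?_) (le_principal_iff.2 (hkey.mono fun _ h ↦ h.1))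
  rw [(key σ hσ hσp hσz).2]
  have hca : ContinuousAt (Function.uncurry α) (chartLift p σ t₁, t₂ - t₁) :=
    hcont.continuousAt (prod_mem_nhds
      (mem_of_superset (Metric.isOpen_ball.mem_nhds hσz) Metric.ball_subset_closedBall)
      (Icc_mem_nhds h12'.1 h12'.2))
  have := hca.tendsto.comp (hlim.prodMk_nhds (tendsto_const_nhds (x := t₂ - t₁)))
  exact this.congr' (hkey.mono fun _ h ↦ h.2.symm)

/-- The velocity at time `τ` of a geodesic depends continuously on its initial velocity. -/
theorem Metric.liftNhds_inf_le {τ : ℝ} (hτ : 0 ≤ τ) {σ : ℝ → M} (hσ : σ ∈ g.geodesicSegments τ) :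
    liftNhds (E := E) (σ 0) σ 0 ⊓ 𝓟 (g.geodesicSegments τ) ≤ liftNhds (E := E) (σ τ) σ τ := by
  have hcontσ : ∀ t ∈ Icc 0 τ, ContinuousAt σ t := fun t ht ↦
    (isGeodesicAt_of_mem_geodesicSegments hσ ht).1.continuousAt
  -- The relation between times is transitive and holds in both directions for nearby times, so
  -- connectedness of `[0, τ]` carries it from `0` to `τ`.
  refine isPreconnected_Icc.induction₂' (s := Icc 0 τ) (fun t₁ t₂ ↦
    liftNhds (E := E) (σ t₁) σ t₁ ⊓ 𝓟 (g.geodesicSegments τ) ≤ liftNhds (E := E) (σ t₂) σ t₂)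
    (fun t ht ↦ ?_) (fun t₁ t₂ t₃ _ _ _ h h' ↦ (le_inf h inf_le_right).trans h')
    (left_mem_Icc.2 hτ) (right_mem_Icc.2 hτ)
  have hp : σ t ∈ (extChartAt 𝓘(ℝ, E) (σ t)).source := mem_extChartAt_source _
  obtain ⟨r, hr, ε, hε, hloc⟩ := g.exists_liftNhds_inf_le
    (z₀ := chartLift (E := E) (σ t) σ t) ((extChartAt 𝓘(ℝ, E) (σ t)).map_source hp) τ
  have hc := (contDiffAt_chartLift (isGeodesicAt_of_mem_geodesicSegments hσ ht).1 hp).continuousAt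
  have hev : ∀ᶠ t' in 𝓝 t, σ t' ∈ (extChartAt 𝓘(ℝ, E) (σ t)).source ∧
      chartLift (E := E) (σ t) σ t' ∈ Metric.ball (chartLift (σ t) σ t) r ∧ |t' - t| < ε :=
    ((hcontσ t ht).eventually (extChartAt_source_mem_nhds_of_mem hp)).and
      ((hc.eventually (Metric.ball_mem_nhds _ hr)).and
        (Metric.eventually_nhds_iff.2 ⟨ε, hε, fun _ h ↦ h⟩))
  filter_upwards [nhdsWithin_le_nhds hev, self_mem_nhdsWithin] with t' ⟨h1, h2, h3⟩ ht'
  constructor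
  · exact (le_inf (hloc t ht t' ht' h3 σ hσ hp (Metric.mem_ball_self hr)) inf_le_right).trans
      (g.liftNhds_inf_le_of_mem_source ht' hσ h1 (mem_extChartAt_source _))
  · exact (le_inf (g.liftNhds_inf_le_of_mem_source ht' hσ (mem_extChartAt_source _) h1)
      inf_le_right).trans (hloc t' ht' t ht (by rwa [abs_sub_comm]) σ hσ h1 h2)

end Dependence

/-! ### Second countability from geodesics -/

section SecondCountable

lemma exists_countable_closed_under {X : Type*} (C : X → ℕ → Set X) (hC : ∀ x n, (C x n).Countable)
    (x₀ : X) : ∃ A : Set X, A.Countable ∧ x₀ ∈ A ∧ ∀ x ∈ A, ∀ n, C x n ⊆ A := by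
  let step : Set X → Set X := fun A ↦ ⋃ x ∈ A, ⋃ n, C x n
  let A : ℕ → Set X := fun k ↦ Nat.rec {x₀} (fun _ A ↦ step A) k
  have hA : ∀ k, (A k).Countable := by
    intro k
    induction k with
    | zero => exact countable_singleton x₀
    | succ k ih => exact ih.biUnion fun x _ ↦ countable_iUnion fun n ↦ hC x n
  refine ⟨⋃ k, A k, countable_iUnion hA, mem_iUnion.2 ⟨0, rfl⟩, fun x hx n y hy ↦ ?_⟩
  obtain ⟨k, hk⟩ := mem_iUnion.1 hx
  exact mem_iUnion.2 ⟨k + 1, mem_biUnion hk (mem_iUnion.2 ⟨n, hy⟩)⟩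

variable {E : Type*} [NormedAddCommGroup E] [NormedSpace ℝ E] [FiniteDimensional ℝ E]
  {M : Type*} [TopologicalSpace M] [ChartedSpace E M] [IsManifold 𝓘(ℝ, E) ∞ M]
  (g : Metric E M)

/-- The points close to `x` are joined to `x` by geodesics of a fixed duration. -/
lemma Metric.exists_geodesicSegment_to (x : M) :
    ∃ n : ℕ, ∀ᶠ y in 𝓝 x, ∃ σ ∈ g.geodesicSegments (1 / (n + 1)), σ 0 = y ∧
      σ (1 / (n + 1)) = x := by
  set φ := extChartAt 𝓘(ℝ, E) x with hφ
  have hx : φ x ∈ φ.target := mem_extChartAt_target x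
  have hU : φ.target ×ˢ (univ : Set E) ∈ 𝓝 (φ x, (0 : E)) :=
    ((isOpen_extChartAt_target x).prod isOpen_univ).mem_nhds ⟨hx, mem_univ _⟩
  obtain ⟨ε, hε, H⟩ := exists_solution_through (f := fun z ↦ -g.christoffel x z.1 z.2 z.2)
    (y₀ := φ x) ((g.contDiffAt_spray (z := (φ x, 0)) hx).of_le (m := 1) (by simp))
    (by simp [g.christoffel_zero]) hU
  obtain ⟨n, hn⟩ := exists_nat_one_div_lt hε
  have hpos : (0 : ℝ) < 1 / (n + 1) := Nat.one_div_pos_of_nat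
  -- Geodesics are shot backwards from `x`, for time `-1 / (n + 1)`, and then reparametrized to
  -- arrive at `x`. Durations of this form are countably many, which the closure argument below
  -- requires.
  obtain ⟨V, hV, HV⟩ := H (-(1 / (n + 1))) (by linarith) (by rwa [abs_neg, abs_of_pos hpos])
  refine ⟨n, ?_⟩
  filter_upwards [(continuousAt_extChartAt x).preimage_mem_nhds hV,
    extChartAt_source_mem_nhds (I := 𝓘(ℝ, E)) x] with y hy hys
  obtain ⟨z, hz, hz0, hzs⟩ := HV _ hy
  refine ⟨fun t ↦ φ.symm (z (t - 1 / (n + 1))).1, ⟨ε - 1 / (n + 1), by linarith, fun t ht ↦ ?_⟩,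
    ?_, ?_⟩
  · have hev : ∀ᶠ τ in 𝓝 t, HasDerivAt (fun τ ↦ z (τ - 1 / (n + 1)))
        (g.spray x (z (τ - 1 / (n + 1)))) τ ∧ (z (τ - 1 / (n + 1))).1 ∈ φ.target := by
      filter_upwards [Ioo_mem_nhds ht.1 ht.2] with τ hτ
      have h := hz (τ - 1 / (n + 1)) ⟨by linarith [hτ.1], by linarith [hτ.2]⟩
      exact ⟨HasDerivAt.comp_sub_const τ _ h.1, h.2.1⟩
    exact (g.isGeodesicAt_of_hasDerivAt_spray hev).1
  · simp only [zero_sub]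
    rw [hzs]
    exact φ.left_inv hys
  · simp only [sub_self]
    rw [hz0]
    exact φ.left_inv (mem_extChartAt_source x)

/-- The end points of the geodesics of duration `τ` starting in the domain of a chart are covered
by countably many domains of charts. -/
lemma Metric.exists_countable_cover_endpoints [T2Space M] (p : M) {τ : ℝ} (hτ : 0 ≤ τ) :
    ∃ C : Set M, C.Countable ∧ ∀ σ ∈ g.geodesicSegments τ,
      σ 0 ∈ (extChartAt 𝓘(ℝ, E) p).source → ∃ q ∈ C, σ τ ∈ (extChartAt 𝓘(ℝ, E) q).source := by
  let D : Set (E × E) := {z | ∃ σ ∈ g.geodesicSegments τ,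
    σ 0 ∈ (extChartAt 𝓘(ℝ, E) p).source ∧ chartLift p σ 0 = z}
  have hD : ∀ z ∈ D, ∃ q : M, ∃ N ∈ 𝓝 z, ∀ σ ∈ g.geodesicSegments τ,
      σ 0 ∈ (extChartAt 𝓘(ℝ, E) p).source → chartLift p σ 0 ∈ N →
      σ τ ∈ (extChartAt 𝓘(ℝ, E) q).source := by
    rintro z ⟨σ, hσ, hp, rfl⟩
    refine ⟨σ τ, ?_⟩
    have h1 : {σ' : ℝ → M | σ' τ ∈ (extChartAt 𝓘(ℝ, E) (σ τ)).source} ∈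
        liftNhds (E := E) (σ τ) σ τ := mem_inf_of_right (mem_principal_self _)
    have h2 := (le_inf (g.liftNhds_inf_le_of_mem_source (left_mem_Icc.2 hτ) hσ hp
      (mem_extChartAt_source (σ 0))) inf_le_right).trans (g.liftNhds_inf_le hτ hσ) h1
    -- Unfolds the filter inequality into a neighborhood `N` of the initial velocity all of whose
    -- geodesics end in the chart domain at `σ τ`.
    rw [liftNhds, inf_assoc, inf_principal, mem_inf_principal, mem_comap] at h2
    obtain ⟨N, hN, hsub⟩ := h2
    exact ⟨N, hN, fun σ' h h' h'' ↦ hsub h'' ⟨h', h⟩⟩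
  have : Nonempty M := ⟨p⟩
  choose! q N hN hqN using hD
  have := FiniteDimensional.proper ℝ (E × E)
  -- `E × E` is second countable, so countably many of these neighborhoods cover the set `D` of
  -- initial velocities.
  obtain ⟨T, hTD, hTc, hT⟩ := TopologicalSpace.countable_cover_nhdsWithin
    (fun z hz ↦ mem_nhdsWithin_of_mem_nhds (hN z hz)) (s := D)
  refine ⟨q '' T, hTc.image q, fun σ hσ hp ↦ ?_⟩
  obtain ⟨z, hzT, hz⟩ := mem_iUnion₂.1 (hT ⟨σ, hσ, hp, rfl⟩)
  exact ⟨q z, mem_image_of_mem q hzT, hqN z (hTD hzT) σ hσ hp hz⟩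

/-- A connected Hausdorff manifold with a semi-Riemannian metric is second countable. -/
theorem Metric.secondCountableTopology (g : Metric E M) [T2Space M] [ConnectedSpace M] :
    SecondCountableTopology M := by
  have hn : ∀ n : ℕ, (0 : ℝ) ≤ 1 / (n + 1) := fun n ↦ by positivity
  choose C hC hCσ using fun (p : M) (n : ℕ) ↦ g.exists_countable_cover_endpoints p (hn n)
  obtain ⟨x₀⟩ : Nonempty M := inferInstance
  obtain ⟨A, hA, hx₀, hcl⟩ := exists_countable_closed_under C hC x₀
  let S : Set M := ⋃ p ∈ A, (extChartAt 𝓘(ℝ, E) p).source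
  have hopen : IsOpen S := isOpen_biUnion fun p _ ↦ isOpen_extChartAt_source p
  -- A limit point `x` of `S` is reached by a geodesic of duration `1 / (n + 1)` from a point of
  -- some chart domain in the family, so it lies in a chart domain which the closure property puts
  -- in the family.
  have hclosed : IsClosed S := by
    rw [← closure_subset_iff_isClosed]
    intro x hx
    obtain ⟨n, hev⟩ := g.exists_geodesicSegment_to x
    obtain ⟨y, hyS, σ, hσ, rfl, rfl⟩ := ((mem_closure_iff_frequently.1 hx).and_eventually hev).exists
    obtain ⟨p, hp, hyp⟩ := mem_iUnion₂.1 hyS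
    obtain ⟨q, hq, hxq⟩ := hCσ p n σ hσ hyp
    exact mem_biUnion (hcl p hp n hq) hxq
  have huniv : S = univ := IsClopen.eq_univ ⟨hclosed, hopen⟩
    ⟨x₀, mem_biUnion hx₀ (mem_extChartAt_source x₀)⟩
  have := FiniteDimensional.proper ℝ E
  refine ChartedSpace.secondCountable_of_countable_cover E (s := A) ?_ hA
  simpa [S, extChartAt_source] using huniv

end SecondCountable

/-! ### Riemannian distance and a criterion for completeness -/

section Distance

variable {E : Type*} [NormedAddCommGroup E] [NormedSpace ℝ E]
  {M : Type*} [TopologicalSpace M] [ChartedSpace E M] [IsManifold 𝓘(ℝ, E) ∞ M]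

lemma isContinuousRiemannianBundle (gR : RiemMetric E M) :
    letI : Bundle.RiemannianBundle (fun x : M ↦ TangentSpace 𝓘(ℝ, E) x) := ⟨gR.toRiemannianMetric⟩
    IsContinuousRiemannianBundle E (fun x : M ↦ TangentSpace 𝓘(ℝ, E) x) := by
  let : Bundle.RiemannianBundle (fun x : M ↦ TangentSpace 𝓘(ℝ, E) x) := ⟨gR.toRiemannianMetric⟩
  exact ⟨gR.inner, gR.contMDiff.continuous, fun _ _ _ ↦ rfl⟩

/-- The length of a tangent vector for the metric `gR`, as an extended nonnegative real. -/
lemma enorm_eq_ofReal_sqrt (gR : RiemMetric E M) {x : M} (v : TangentSpace 𝓘(ℝ, E) x) :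
    letI : Bundle.RiemannianBundle (fun x : M ↦ TangentSpace 𝓘(ℝ, E) x) := ⟨gR.toRiemannianMetric⟩
    ‖v‖ₑ = ENNReal.ofReal √(gR.inner x v v) := by
  let : Bundle.RiemannianBundle (fun x : M ↦ TangentSpace 𝓘(ℝ, E) x) := ⟨gR.toRiemannianMetric⟩
  have h : ‖v‖ = √(gR.inner x v v) := norm_eq_sqrt_real_inner v
  rw [← h, ofReal_norm]

/-- Along a curve the derivative of `f` is at most the speed; integrating shows that `f` varies by
no more than the length. -/
lemma enorm_sub_le_riemDist {gR : RiemMetric E M} {f : M → ℝ}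
    (hf : ContMDiff 𝓘(ℝ, E) 𝓘(ℝ, ℝ) ∞ f)
    (hfg : ∀ x (v : TangentSpace 𝓘(ℝ, E) x),
      (letI d : ℝ := mfderiv 𝓘(ℝ, E) 𝓘(ℝ, ℝ) f x v; d ^ 2) ≤ gR.inner x v v) (x y : M) :
    ‖f y - f x‖ₑ ≤ riemDist gR x y := by
  let : Bundle.RiemannianBundle (fun x : M ↦ TangentSpace 𝓘(ℝ, E) x) := ⟨gR.toRiemannianMetric⟩
  refine le_of_forall_gt fun r hr ↦ ?_
  obtain ⟨c, rfl, rfl, hc, hlen⟩ := Manifold.exists_lt_of_riemannianEDist_lt hr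
  refine lt_of_le_of_lt ?_ hlen
  have hfc : ContMDiffOn 𝓘(ℝ, ℝ) 𝓘(ℝ, ℝ) 1 (f ∘ c) (Icc 0 1) :=
    (hf.of_le (by simp)).comp_contMDiffOn hc
  refine (enorm_sub_le_lintegral_derivWithin_Icc_of_contDiffOn_Icc
    (contMDiffOn_iff_contDiffOn.1 hfc) zero_le_one).trans ?_
  rw [Manifold.pathELength_eq_lintegral_mfderivWithin_Icc]
  refine MeasureTheory.setLIntegral_mono' measurableSet_Icc fun t ht ↦ ?_
  have hd : derivWithin (f ∘ c) (Icc 0 1) t = mfderiv 𝓘(ℝ, E) 𝓘(ℝ, ℝ) f (c t)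
      (mfderivWithin 𝓘(ℝ, ℝ) 𝓘(ℝ, E) c (Icc 0 1) t (1 : ℝ)) := by
    have hu : UniqueMDiffWithinAt 𝓘(ℝ, ℝ) (Icc (0 : ℝ) 1) t :=
      (uniqueDiffOn_Icc zero_lt_one t ht).uniqueMDiffWithinAt
    have h1 := mfderiv_comp_mfderivWithin t ((hf (c t)).mdifferentiableAt (by simp))
      (hc.mdifferentiableOn one_ne_zero t ht) hu
    rw [mfderivWithin_eq_fderivWithin] at h1
    exact congrArg (fun L : ℝ →L[ℝ] ℝ ↦ L 1) h1
  rw [enorm_eq_ofReal_sqrt, Real.enorm_eq_ofReal_abs]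
  refine ENNReal.ofReal_le_ofReal (Real.le_sqrt_of_sq_le ?_)
  rw [sq_abs, hd]
  exact hfg _ _

lemma tendsto_riemDist (gR : RiemMetric E M) {ι : Type*} {l : Filter ι} {u : ι → M} {y : M}
    (hu : Tendsto u l (𝓝 y)) : Tendsto (fun i ↦ riemDist gR (u i) y) l (𝓝 0) := by
  let : Bundle.RiemannianBundle (fun x : M ↦ TangentSpace 𝓘(ℝ, E) x) := ⟨gR.toRiemannianMetric⟩
  have := isContinuousRiemannianBundle gR
  rw [ENNReal.tendsto_nhds_zero]
  intro ε hε
  filter_upwards [hu.eventually (eventually_riemannianEDist_lt 𝓘(ℝ, E) y hε)] with i hi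
  rw [Manifold.riemannianEDist_comm] at hi
  exact hi.le

lemma riemDist_triangle (gR : RiemMetric E M) (x y z : M) :
    riemDist gR x z ≤ riemDist gR x y + riemDist gR y z := by
  let : Bundle.RiemannianBundle (fun x : M ↦ TangentSpace 𝓘(ℝ, E) x) := ⟨gR.toRiemannianMetric⟩
  exact Manifold.riemannianEDist_triangle

/-- `f` is 1-Lipschitz, so it is bounded above on the tail of a Cauchy sequence. The tail stays in a
compact set, and a Cauchy sequence with a convergent subsequence converges. -/
lemma isCompleteMetric_of_isCompact_sublevel [SecondCountableTopology M] {gR : RiemMetric E M}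
    {f : M → ℝ} (hf : ContMDiff 𝓘(ℝ, E) 𝓘(ℝ, ℝ) ∞ f)
    (hfc : ∀ c, ∃ K, IsCompact K ∧ {x | f x ≤ c} ⊆ K)
    (hfg : ∀ x (v : TangentSpace 𝓘(ℝ, E) x),
      (letI d : ℝ := mfderiv 𝓘(ℝ, E) 𝓘(ℝ, ℝ) f x v; d ^ 2) ≤ gR.inner x v v) :
    IsCompleteMetric gR := by
  intro x hx
  obtain ⟨N, hN⟩ := hx 1 one_pos
  obtain ⟨K, hK, hfK⟩ := hfc (f (x N) + 1)
  have hxK : ∀ n, x (n + N) ∈ K := fun n ↦ hfK <| by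
    have h := (enorm_sub_le_riemDist hf hfg (x N) (x (n + N))).trans_lt
      (hN N le_rfl (n + N) (Nat.le_add_left _ _))
    rw [Real.enorm_eq_ofReal_abs, ENNReal.ofReal_lt_one] at h
    have := (le_abs_self _).trans_lt h
    change f (x (n + N)) ≤ f (x N) + 1
    linarith
  obtain ⟨y, -, φ, hφ, hy⟩ := hK.tendsto_subseq hxK
  refine ⟨y, ENNReal.tendsto_nhds_zero.2 fun ε hε ↦ ?_⟩
  obtain ⟨N', hN'⟩ := hx (ε / 2) (ENNReal.half_pos hε.ne')
  filter_upwards [eventually_ge_atTop N'] with n hn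
  obtain ⟨k, hk, hkN⟩ := ((ENNReal.tendsto_nhds_zero.1 (tendsto_riemDist gR hy) (ε / 2)
    (ENNReal.half_pos hε.ne')).and (eventually_ge_atTop N')).exists
  calc riemDist gR (x n) y ≤ riemDist gR (x n) (x (φ k + N)) + riemDist gR (x (φ k + N)) y :=
        riemDist_triangle gR _ _ _
    _ ≤ ε / 2 + ε / 2 := by
        gcongr
        · exact (hN' n hn _ ((hkN.trans (hφ.id_le k)).trans (Nat.le_add_right _ _))).le
        · exact hk
    _ = ε := ENNReal.add_halves ε

end Distance

/-! ### Existence of a complete Riemannian metric -/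

section CompleteMetric

variable {E : Type*} [NormedAddCommGroup E] [NormedSpace ℝ E] [FiniteDimensional ℝ E]
  {M : Type*} [TopologicalSpace M] [ChartedSpace E M]

variable (E) in
-- A partition of unity smooths the index at which a point enters a compact exhaustion: locally, a
-- constant dominates this index, and the condition of dominating it is convex.
lemma exists_contMDiff_isCompact_sublevel [IsManifold 𝓘(ℝ, E) ∞ M] [T2Space M]
    [SigmaCompactSpace M] :
    ∃ f : M → ℝ, ContMDiff 𝓘(ℝ, E) 𝓘(ℝ, ℝ) ∞ f ∧ ∀ c, ∃ K, IsCompact K ∧ {x | f x ≤ c} ⊆ K := by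
  have : LocallyCompactSpace M :=
    haveI := FiniteDimensional.proper ℝ E
    ChartedSpace.locallyCompactSpace E M
  let K := CompactExhaustion.choice M
  obtain ⟨f, hf⟩ := exists_contMDiffMap_forall_mem_convex_of_local_const (n := ⊤) 𝓘(ℝ, E)
    (t := fun x : M ↦ Ici (K.find x : ℝ)) (fun x ↦ convex_Ici _) (fun x ↦ by
      refine ⟨(K.find x + 1 : ℕ), ?_⟩
      filter_upwards [isOpen_interior.mem_nhds (K.subset_interior_succ _ (K.mem_find x))] with y hy
      exact (Nat.cast_le (α := ℝ)).2 (K.mem_iff_find_le.1 (interior_subset hy)))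
  refine ⟨f, f.contMDiff, fun c ↦ ⟨K ⌈c⌉₊, K.isCompact _, fun x hx ↦ ?_⟩⟩
  rw [K.mem_iff_find_le]
  have h1 : (K.find x : ℝ) ≤ f x := hf x
  have h2 : f x ≤ c := hx
  exact_mod_cast (h1.trans h2).trans (Nat.le_ceil c)

variable (E) in
/-- An inner product on the model space, as a continuous bilinear form. -/
def euclideanForm : E →L[ℝ] E →L[ℝ] ℝ :=
  letI A : E →L[ℝ] EuclideanSpace ℝ (Fin (Module.finrank ℝ E)) := (toEuclidean (E := E) : E →L[ℝ] _)
  (innerSL ℝ (E := EuclideanSpace ℝ (Fin (Module.finrank ℝ E))) :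
    EuclideanSpace ℝ (Fin (Module.finrank ℝ E)) →L[ℝ]
      EuclideanSpace ℝ (Fin (Module.finrank ℝ E)) →L[ℝ] ℝ).bilinearComp A A

lemma euclideanForm_symm (v w : E) : euclideanForm E v w = euclideanForm E w v :=
  real_inner_comm (toEuclidean w) (toEuclidean v)

variable (E) in
lemma exists_norm_sq_le_euclideanForm : ∃ c > 0, ∀ v : E, ‖v‖ ^ 2 ≤ c * euclideanForm E v v := by
  let L : EuclideanSpace ℝ (Fin (Module.finrank ℝ E)) →L[ℝ] E := (toEuclidean (E := E)).symm
  refine ⟨‖L‖ ^ 2 + 1, by positivity, fun v ↦ ?_⟩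
  have h : ‖v‖ ≤ ‖L‖ * ‖toEuclidean v‖ := by
    simpa [L] using L.le_opNorm (toEuclidean v)
  have h1 : euclideanForm E v v = ‖toEuclidean v‖ ^ 2 :=
    real_inner_self_eq_norm_sq (toEuclidean v)
  rw [h1]
  have h2 := pow_le_pow_left₀ (norm_nonneg v) h 2
  rw [mul_pow] at h2
  nlinarith [sq_nonneg ‖toEuclidean v‖]

variable [IsManifold 𝓘(ℝ, E) ∞ M]

/-- The pullback to `M` of the inner product of the model space, by the trivialization at `p`. -/
def euclideanInChart (p x : M) :
    TangentSpace 𝓘(ℝ, E) x →L[ℝ] TangentSpace 𝓘(ℝ, E) x →L[ℝ] ℝ :=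
  letI A : E →L[ℝ] E :=
    (trivializationAt E (fun x : M ↦ TangentSpace 𝓘(ℝ, E) x) p).continuousLinearMapAt ℝ x
  ((euclideanForm E).bilinearComp A A : E →L[ℝ] E →L[ℝ] ℝ)

lemma euclideanInChart_apply (p x : M) (v w : TangentSpace 𝓘(ℝ, E) x) :
    euclideanInChart p x v w = euclideanForm E
      ((trivializationAt E (fun x : M ↦ TangentSpace 𝓘(ℝ, E) x) p).continuousLinearMapAt ℝ x v)
      ((trivializationAt E (fun x : M ↦ TangentSpace 𝓘(ℝ, E) x) p).continuousLinearMapAt ℝ x w) :=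
  rfl

/-- Read in the trivialization at `p`, the form is constant. -/
lemma contMDiffOn_euclideanInChart (p : M) (c : ℝ) :
    ContMDiffOn 𝓘(ℝ, E) (𝓘(ℝ, E).prod 𝓘(ℝ, E →L[ℝ] E →L[ℝ] ℝ)) ∞
      (fun x ↦ Bundle.TotalSpace.mk' (E →L[ℝ] E →L[ℝ] ℝ)
        (E := fun x : M ↦ TangentSpace 𝓘(ℝ, E) x →L[ℝ] TangentSpace 𝓘(ℝ, E) x →L[ℝ] ℝ) x
        (c • euclideanInChart p x))
      (trivializationAt E (fun x : M ↦ TangentSpace 𝓘(ℝ, E) x) p).baseSet := by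
  rw [Bundle.Trivialization.contMDiffOn_section_iff
    (e := trivializationAt (E →L[ℝ] E →L[ℝ] ℝ)
      (fun x : M ↦ TangentSpace 𝓘(ℝ, E) x →L[ℝ] TangentSpace 𝓘(ℝ, E) x →L[ℝ] ℝ) p)
    (trivializationAt E (fun x : M ↦ TangentSpace 𝓘(ℝ, E) x) p).open_baseSet
    (by simp [hom_trivializationAt_baseSet])]
  refine (contMDiffOn_const (c := c • euclideanForm E)).congr fun x hx ↦ ?_
  ext v w
  rw [hom_trivializationAt_apply]
  have h := inCoordinates_apply_eq₂ (E₁ := fun x : M ↦ TangentSpace 𝓘(ℝ, E) x)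
    (E₂ := fun x : M ↦ TangentSpace 𝓘(ℝ, E) x) (E₃ := Bundle.Trivial M ℝ) (F₃ := ℝ)
    (ϕ := c • euclideanInChart p x) (v := v) (w := w) hx hx (by simp)
  refine h.trans ?_
  have hA : ∀ u : E, (trivializationAt E (fun x : M ↦ TangentSpace 𝓘(ℝ, E) x)
      p).continuousLinearMapAt ℝ x ((trivializationAt E (fun x : M ↦ TangentSpace 𝓘(ℝ, E) x)
      p).symm x u) = u := fun u ↦ by
    have := (trivializationAt E (fun x : M ↦ TangentSpace 𝓘(ℝ, E) x)
      p).continuousLinearMapAt_symmL (R := ℝ) hx u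
    rwa [Bundle.Trivialization.symmL_apply _ hx] at this
  simp only [Bundle.Trivial.linearMapAt_trivialization, 
    Bundle.Trivial.fiberBundle_trivializationAt', LinearMap.id_apply]
  change c * euclideanInChart p x _ _ = c * _
  rw [euclideanInChart_apply, hA, hA]
  rfl

/-- The differential of a real function is locally bounded in the trivialization. -/
lemma eventually_sq_mfderiv_lt {f : M → ℝ} (hf : ContMDiff 𝓘(ℝ, E) 𝓘(ℝ, ℝ) ∞ f) (p : M) :
    ∃ c : ℝ, ∀ᶠ x in 𝓝 p, ∀ v : TangentSpace 𝓘(ℝ, E) x, v ≠ 0 →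
      (letI d : ℝ := mfderiv 𝓘(ℝ, E) 𝓘(ℝ, ℝ) f x v; d ^ 2) < c * euclideanInChart p x v v := by
  obtain ⟨k, hk, hkE⟩ := exists_norm_sq_le_euclideanForm E
  let F : E → ℝ := f ∘ (extChartAt 𝓘(ℝ, E) p).symm
  have hF : ∀ y ∈ (extChartAt 𝓘(ℝ, E) p).target, ContDiffAt ℝ ∞ F y := fun y hy ↦
    contMDiffAt_iff_contDiffAt.1 ((hf _).comp y (contMDiffAt_extChartAt_symm_of_mem hy))
  have hcont : ContinuousAt (fderiv ℝ F) (extChartAt 𝓘(ℝ, E) p p) :=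
    ((hF _ (mem_extChartAt_target p)).fderiv_right (m := 0) (by simp)).continuousAt
  have hbound : ∀ᶠ x in 𝓝 p, ‖fderiv ℝ F (extChartAt 𝓘(ℝ, E) p x)‖ <
      ‖fderiv ℝ F (extChartAt 𝓘(ℝ, E) p p)‖ + 1 :=
    (hcont.norm.comp (f := extChartAt 𝓘(ℝ, E) p) (x := p) (continuousAt_extChartAt p)).eventually_lt
      continuousAt_const (by simp)
  set K := ‖fderiv ℝ F (extChartAt 𝓘(ℝ, E) p p)‖ + 1
  refine ⟨K ^ 2 * k, ?_⟩
  filter_upwards [hbound, extChartAt_source_mem_nhds (I := 𝓘(ℝ, E)) p] with x hx hxs v hv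
  have hxc : x ∈ (chartAt E p).source := by simpa using hxs
  have hd : mfderiv 𝓘(ℝ, E) 𝓘(ℝ, ℝ) f x v = fderiv ℝ F (extChartAt 𝓘(ℝ, E) p x)
      ((trivializationAt E (fun x : M ↦ TangentSpace 𝓘(ℝ, E) x) p).continuousLinearMapAt ℝ x v) := by
    have h1 : f =ᶠ[𝓝 x] F ∘ extChartAt 𝓘(ℝ, E) p := by
      filter_upwards [extChartAt_source_mem_nhds_of_mem hxs] with y hy
      simp only [F, Function.comp_apply]
      rw [(extChartAt 𝓘(ℝ, E) p).left_inv hy]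
    rw [h1.mfderiv_eq, mfderiv_comp x
      ((hF _ ((extChartAt 𝓘(ℝ, E) p).map_source hxs)).differentiableAt
        (by simp)).mdifferentiableAt
      ((contMDiffAt_extChartAt_of_mem hxs).mdifferentiableAt (by simp)), mfderiv_eq_fderiv,
      TangentBundle.continuousLinearMapAt_trivializationAt hxc]
    rfl
  have hv' : (trivializationAt E (fun x : M ↦ TangentSpace 𝓘(ℝ, E) x) p).continuousLinearMapAt ℝ x v
      ≠ 0 := by
    intro h0
    have := (trivializationAt E (fun x : M ↦ TangentSpace 𝓘(ℝ, E) x) p).symmL_continuousLinearMapAt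
      (R := ℝ) (b := x) hxc v
    rw [h0, map_zero] at this
    exact hv this.symm
  rw [euclideanInChart_apply]
  generalize (trivializationAt E (fun x : M ↦ TangentSpace 𝓘(ℝ, E) x) p).continuousLinearMapAt ℝ x v
    = w at hd hv'
  have h1 : ‖fderiv ℝ F (extChartAt 𝓘(ℝ, E) p x) w‖ < K * ‖w‖ :=
    ((fderiv ℝ F (extChartAt 𝓘(ℝ, E) p x)).le_opNorm w).trans_lt
      (mul_lt_mul_of_pos_right hx (norm_pos_iff.2 hv'))
  have h2 := pow_lt_pow_left₀ h1 (norm_nonneg _) two_ne_zero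
  rw [Real.norm_eq_abs, sq_abs] at h2
  calc _ = (fderiv ℝ F (extChartAt 𝓘(ℝ, E) p x) w) ^ 2 := congrArg (fun d : ℝ ↦ d ^ 2) hd
    _ < (K * ‖w‖) ^ 2 := h2
    _ = K ^ 2 * ‖w‖ ^ 2 := mul_pow _ _ _
    _ ≤ K ^ 2 * (k * euclideanForm E w w) := by gcongr; exact hkE w
    _ = _ := (mul_assoc _ _ _).symm

/-- By compactness of the unit sphere, `B v v ≥ r * ‖v‖ ^ 2` for some `r > 0`. A Riemannian metric
bundles this boundedness as a field. -/
lemma isVonNBounded_of_pos (B : E →L[ℝ] E →L[ℝ] ℝ) (hB : ∀ v, v ≠ 0 → 0 < B v v) :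
    Bornology.IsVonNBounded ℝ {v : E | B v v < 1} := by
  have := FiniteDimensional.proper ℝ E
  obtain ⟨r, hr, hrB⟩ := (isCompact_sphere (0 : E) 1).exists_forall_le' (f := fun v ↦ B v v) (a := 0)
    (by fun_prop) (fun v hv ↦ hB v (by rintro rfl; simp at hv))
  refine (NormedSpace.isVonNBounded_closedBall ℝ E (√(1 / r))).subset fun v hv ↦ ?_
  rw [mem_closedBall_zero_iff]
  rcases eq_or_ne v 0 with rfl | hv0
  · simp
  have hn := norm_pos_iff.2 hv0
  have h := hrB (‖v‖⁻¹ • v) (by simp [norm_smul, hn.ne'])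
  simp only [map_smul, smul_apply, smul_eq_mul] at h
  have hv1 : B v v < 1 := hv
  refine Real.le_sqrt_of_sq_le ?_
  rw [le_div_iff₀ hr]
  calc ‖v‖ ^ 2 * r ≤ ‖v‖ ^ 2 * (‖v‖⁻¹ * (‖v‖⁻¹ * B v v)) := by gcongr
    _ = B v v := by field_simp
    _ ≤ 1 := hv1.le

/-- Symmetric forms strictly dominating `df²` on nonzero vectors form a convex set in each fiber, so
local choices glue by a partition of unity. Strictness makes the result positive definite even where
`df` vanishes. -/
lemma exists_riemMetric_sq_mfderiv_le [T2Space M] [SigmaCompactSpace M] {f : M → ℝ}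
    (hf : ContMDiff 𝓘(ℝ, E) 𝓘(ℝ, ℝ) ∞ f) :
    ∃ gR : RiemMetric E M, ∀ x (v : TangentSpace 𝓘(ℝ, E) x),
      (letI d : ℝ := mfderiv 𝓘(ℝ, E) 𝓘(ℝ, ℝ) f x v; d ^ 2) ≤ gR.inner x v v := by
  obtain ⟨B, hB⟩ := exists_contMDiffSection_forall_mem_convex_of_local (n := ⊤) 𝓘(ℝ, E)
    (F_fiber := E →L[ℝ] E →L[ℝ] ℝ)
    (fun x : M ↦ TangentSpace 𝓘(ℝ, E) x →L[ℝ] TangentSpace 𝓘(ℝ, E) x →L[ℝ] ℝ)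
    (fun x ↦ {B | (∀ v w, B v w = B w v) ∧ ∀ v : TangentSpace 𝓘(ℝ, E) x, v ≠ 0 →
      (letI d : ℝ := mfderiv 𝓘(ℝ, E) 𝓘(ℝ, ℝ) f x v; d ^ 2) < B v v})
    (fun x B hB B' hB' a a' ha ha' haa ↦ by
      refine ⟨fun v w ↦ ?_, fun v hv ↦ ?_⟩
      · change a * B v w + a' * B' v w = a * B w v + a' * B' w v
        rw [hB.1, hB'.1]
      · have h1 := hB.2 v hv
        have h2 := hB'.2 v hv
        change _ < a * B v v + a' * B' v v
        exact (convex_Ioi (𝕜 := ℝ) (_ : ℝ)) (mem_Ioi.2 h1) (mem_Ioi.2 h2) ha ha' haa)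
    (fun p ↦ by
      obtain ⟨c, hc⟩ := eventually_sq_mfderiv_lt hf p
      refine ⟨_, inter_mem ((trivializationAt E (fun x : M ↦ TangentSpace 𝓘(ℝ, E) x)
        p).open_baseSet.mem_nhds (mem_chart_source E p)) hc, fun x ↦ c • euclideanInChart p x,
        (contMDiffOn_euclideanInChart p c).mono inter_subset_left, fun x hx ↦ ⟨fun v w ↦ ?_, hx.2⟩⟩
      change c * euclideanInChart p x v w = c * euclideanInChart p x w v
      rw [euclideanInChart_apply, euclideanForm_symm, euclideanInChart_apply])
  have hpos : ∀ (x : M) (v : TangentSpace 𝓘(ℝ, E) x), v ≠ 0 → 0 < B x v v := fun x v hv ↦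
    (sq_nonneg _).trans_lt ((hB x).2 v hv)
  refine ⟨⟨fun x ↦ B x, fun x ↦ (hB x).1, hpos, fun x ↦ ?_, B.contMDiff⟩, fun x v ↦ ?_⟩
  · exact isVonNBounded_of_pos (E := E) (B x) (hpos x)
  · rcases eq_or_ne v 0 with rfl | hv
    · rw [map_zero, map_zero]
      exact (zero_pow (M₀ := ℝ) two_ne_zero).le
    · exact ((hB x).2 v hv).le

variable (E M) in
theorem exists_isCompleteMetric [T2Space M] [SecondCountableTopology M] :
    ∃ gR : RiemMetric E M, IsCompleteMetric gR := by
  have : LocallyCompactSpace M :=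
    haveI := FiniteDimensional.proper ℝ E
    ChartedSpace.locallyCompactSpace E M
  obtain ⟨f, hf, hfc⟩ := exists_contMDiff_isCompact_sublevel E (M := M)
  obtain ⟨gR, hgR⟩ := exists_riemMetric_sq_mfderiv_le hf
  exact ⟨gR, isCompleteMetric_of_isCompact_sublevel hf hfc hgR⟩

end CompleteMetric

/-! ### Consequences of extendibility -/

section VelocityCurve

variable {E : Type*} [NormedAddCommGroup E] [NormedSpace ℝ E]
  {M : Type*} [TopologicalSpace M] [ChartedSpace E M]

lemma velocity_eq_of_eqOn {γ σ : ℝ → M} {b b' : ℝ} (hbb' : b < b') (h : EqOn σ γ (Ico 0 b))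
    {t : ℝ} (ht : t ∈ Ico 0 b) :
    (⟨γ t, velocity γ (Ico 0 b) t⟩ : TangentBundle 𝓘(ℝ, E) M) =
      ⟨σ t, velocity σ (Ico 0 b') t⟩ := by
  have h1 : mfderivWithin 𝓘(ℝ, ℝ) 𝓘(ℝ, E) σ (Ico 0 b') t =
      mfderivWithin 𝓘(ℝ, ℝ) 𝓘(ℝ, E) σ (Ico 0 b) t :=
    mfderivWithin_congr_set (Ico_eventuallyEq_of_lt (ht.2.trans hbb') ht.2)
  have h2 := tangentMapWithin_congr (I := 𝓘(ℝ, ℝ)) (I' := 𝓘(ℝ, E)) (fun x hx ↦ (h hx).symm)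
    (⟨t, (1 : ℝ)⟩ : TangentBundle 𝓘(ℝ, ℝ) ℝ) ht
  refine h2.trans ?_
  rw [velocity, h1]
  rfl

variable [IsManifold 𝓘(ℝ, E) ∞ M]

lemma continuousOn_velocity {σ : ℝ → M} {s : Set ℝ} (hs : UniqueDiffOn ℝ s)
    (hσ : ContMDiffOn 𝓘(ℝ, ℝ) 𝓘(ℝ, E) ∞ σ s) :
    ContinuousOn (fun t ↦ (⟨σ t, velocity σ s t⟩ : TangentBundle 𝓘(ℝ, E) M)) s := by
  have h1 : Continuous (fun t : ℝ ↦ (⟨t, (1 : ℝ)⟩ : TangentBundle 𝓘(ℝ, ℝ) ℝ)) :=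
    (tangentBundleModelSpaceHomeomorph 𝓘(ℝ, ℝ)).symm.continuous.comp
      (Continuous.prodMk continuous_id continuous_const : Continuous fun t : ℝ ↦ (t, (1 : ℝ)))
  exact (hσ.continuousOn_tangentMapWithin (by simp) hs.uniqueMDiffOn).comp h1.continuousOn
    fun t ht ↦ ht

lemma continuous_sqrt_inner_self (gR : RiemMetric E M) :
    Continuous fun z : TangentBundle 𝓘(ℝ, E) M ↦ √(gR.inner z.1 z.2 z.2) := by
  let : Bundle.RiemannianBundle (fun x : M ↦ TangentSpace 𝓘(ℝ, E) x) := ⟨gR.toRiemannianMetric⟩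
  have := isContinuousRiemannianBundle gR
  have hid : Continuous fun z : TangentBundle 𝓘(ℝ, E) M ↦ (⟨z.1, z.2⟩ : TangentBundle 𝓘(ℝ, E) M) :=
    continuous_id
  exact (Continuous.inner_bundle (F := E) (E := fun x : M ↦ TangentSpace 𝓘(ℝ, E) x)
    (b := fun z : TangentBundle 𝓘(ℝ, E) M ↦ z.1) (v := fun z ↦ z.2) (w := fun z ↦ z.2)
    hid hid).sqrt

/-- The speed of the extension is continuous on the compact interval `[0, b]`; completeness of `gR`
plays no role. -/
theorem boundedSpeedOn_of_isExtendibleBeyond {g : Metric E M} {γ : ℝ → M} {b : ℝ}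
    (h : g.IsExtendibleBeyond γ b) (gR : RiemMetric E M) : BoundedSpeedOn gR γ (Ico 0 b) := by
  obtain ⟨b', hbb', σ, hσ, hσγ⟩ := h
  have hcont : ContinuousOn (fun t ↦ √(gR.inner (σ t) (velocity σ (Ico 0 b') t)
      (velocity σ (Ico 0 b') t))) (Icc 0 b) :=
    (continuous_sqrt_inner_self gR).comp_continuousOn
      ((continuousOn_velocity (uniqueDiffOn_Ico _ _) hσ.1).mono fun t ht ↦
        ⟨ht.1, ht.2.trans_lt hbb'⟩)
  obtain ⟨C, hC⟩ := (isCompact_Icc.image_of_continuousOn hcont).bddAbove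
  refine ⟨C, fun t ht ↦ ?_⟩
  have h1 := congrArg (fun z : TangentBundle 𝓘(ℝ, E) M ↦ √(gR.inner z.1 z.2 z.2))
    (velocity_eq_of_eqOn (E := E) hbb' hσγ ht)
  exact h1.trans_le (hC ⟨t, ⟨ht.1, ht.2.le⟩, rfl⟩)

theorem tendsto_velocity_of_isExtendibleBeyond {g : Metric E M} {γ : ℝ → M} {b : ℝ} (hb : 0 < b)
    (h : g.IsExtendibleBeyond γ b) : ∃ v : TangentBundle 𝓘(ℝ, E) M, ∀ s : ℕ → ℝ,
      (∀ n, s n ∈ Ico 0 b) → Tendsto s atTop (𝓝 b) →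
      Tendsto (fun n ↦ (⟨γ (s n), velocity γ (Ico 0 b) (s n)⟩ : TangentBundle 𝓘(ℝ, E) M))
        atTop (𝓝 v) := by
  obtain ⟨b', hbb', σ, hσ, hσγ⟩ := h
  refine ⟨⟨σ b, velocity σ (Ico 0 b') b⟩, fun s hs hsb ↦ ?_⟩
  have hcont := continuousOn_velocity (uniqueDiffOn_Ico _ _) hσ.1 b ⟨hb.le, hbb'⟩
  refine (hcont.tendsto.comp (tendsto_nhdsWithin_iff.2 ⟨hsb, .of_forall fun n ↦
    ⟨(hs n).1, (hs n).2.trans hbb'⟩⟩)).congr fun n ↦ ?_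
  exact (velocity_eq_of_eqOn hbb' hσγ (hs n)).symm

end VelocityCurve

/-! ### From bounded speed to extendibility -/

section BoundedSpeed

variable {E : Type*} [NormedAddCommGroup E] [NormedSpace ℝ E]
  {M : Type*} [TopologicalSpace M] [ChartedSpace E M] [IsManifold 𝓘(ℝ, E) ∞ M]

lemma riemDist_le_of_speed_le {gR : RiemMetric E M} {γ : ℝ → M} {b C : ℝ}
    (hγ : ContMDiffOn 𝓘(ℝ, ℝ) 𝓘(ℝ, E) ∞ γ (Ico 0 b))
    (hC : ∀ t ∈ Ico 0 b, √(gR.inner (γ t) (velocity γ (Ico 0 b) t) (velocity γ (Ico 0 b) t)) ≤ C)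
    {s t : ℝ} (hs : 0 ≤ s) (hst : s ≤ t) (ht : t < b) :
    riemDist gR (γ s) (γ t) ≤ ENNReal.ofReal C * ENNReal.ofReal (t - s) := by
  let : Bundle.RiemannianBundle (fun x : M ↦ TangentSpace 𝓘(ℝ, E) x) := ⟨gR.toRiemannianMetric⟩
  refine (Manifold.riemannianEDist_le_pathELength ((hγ.of_le (by simp)).mono fun u hu ↦
    ⟨hs.trans hu.1, hu.2.trans_lt ht⟩) rfl rfl hst).trans ?_
  rw [Manifold.pathELength_eq_lintegral_mfderiv_Ioo]
  calc _ ≤ ∫⁻ _ in Ioo s t, ENNReal.ofReal C := by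
        refine MeasureTheory.setLIntegral_mono' measurableSet_Ioo fun u hu ↦ ?_
        rw [enorm_eq_ofReal_sqrt, ← mfderivWithin_of_mem_nhds
          (Ico_mem_nhds (hs.trans_lt hu.1) (hu.2.trans ht))]
        exact ENNReal.ofReal_le_ofReal (hC u ⟨hs.trans hu.1.le, hu.2.trans ht⟩)
    _ = _ := by simp

lemma riemDist_comm (gR : RiemMetric E M) (x y : M) : riemDist gR x y = riemDist gR y x := by
  let : Bundle.RiemannianBundle (fun x : M ↦ TangentSpace 𝓘(ℝ, E) x) := ⟨gR.toRiemannianMetric⟩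
  exact Manifold.riemannianEDist_comm

lemma tendsto_of_tendsto_riemDist [RegularSpace M] {gR : RiemMetric E M} {ι : Type*} {l : Filter ι}
    {u : ι → M} {y : M} (hu : Tendsto (fun i ↦ riemDist gR (u i) y) l (𝓝 0)) :
    Tendsto u l (𝓝 y) := by
  let : Bundle.RiemannianBundle (fun x : M ↦ TangentSpace 𝓘(ℝ, E) x) := ⟨gR.toRiemannianMetric⟩
  have := isContinuousRiemannianBundle gR
  intro V hV
  obtain ⟨c, hc, hcV⟩ := setOfPred_riemannianEDist_lt_subset_nhds' 𝓘(ℝ, E) hV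
  rw [mem_map]
  filter_upwards [hu.eventually (Iio_mem_nhds hc)] with i hi
  rw [riemDist_comm] at hi
  exact hcV hi

/-- Bounded speed makes `γ` Lipschitz for the Riemannian distance, so it maps the convergent
sequence `s` to a Cauchy one. -/
lemma exists_tendsto_of_speed_le [RegularSpace M] {gR : RiemMetric E M} (hgR : IsCompleteMetric gR)
    {γ : ℝ → M} {b C : ℝ} (hγ : ContMDiffOn 𝓘(ℝ, ℝ) 𝓘(ℝ, E) ∞ γ (Ico 0 b))
    (hC : ∀ t ∈ Ico 0 b, √(gR.inner (γ t) (velocity γ (Ico 0 b) t) (velocity γ (Ico 0 b) t)) ≤ C)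
    {s : ℕ → ℝ} (hs : ∀ n, s n ∈ Ico 0 b) (hsb : Tendsto s atTop (𝓝 b)) :
    ∃ y, Tendsto (fun n ↦ γ (s n)) atTop (𝓝 y) := by
  have hdist : ∀ m n, riemDist gR (γ (s m)) (γ (s n)) ≤
      ENNReal.ofReal C * ENNReal.ofReal |s m - s n| := by
    intro m n
    rcases le_total (s m) (s n) with h | h
    · rw [abs_sub_comm, abs_of_nonneg (sub_nonneg.2 h)]
      exact riemDist_le_of_speed_le hγ hC (hs m).1 h (hs n).2
    · rw [abs_of_nonneg (sub_nonneg.2 h), riemDist_comm]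
      exact riemDist_le_of_speed_le hγ hC (hs n).1 h (hs m).2
  obtain ⟨y, hy⟩ := hgR (fun n ↦ γ (s n)) fun ε hε ↦ by
    have hlim : Tendsto (fun p : ℕ × ℕ ↦ ENNReal.ofReal C * ENNReal.ofReal |s p.1 - s p.2|)
        (atTop ×ˢ atTop) (𝓝 0) := by
      have h1 : Tendsto (fun p : ℕ × ℕ ↦ |s p.1 - s p.2|) (atTop ×ˢ atTop) (𝓝 |b - b|) :=
        ((hsb.comp tendsto_fst).sub (hsb.comp tendsto_snd)).abs
      have h2 := ENNReal.Tendsto.const_mul (a := ENNReal.ofReal C) (ENNReal.tendsto_ofReal h1)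
        (Or.inr ENNReal.ofReal_ne_top)
      simpa using h2
    rw [prod_atTop_atTop_eq] at hlim
    obtain ⟨N, hN⟩ := eventually_atTop_prod_self.1 (hlim.eventually (Iio_mem_nhds hε))
    exact ⟨N, fun m hm n hn ↦ (hdist m n).trans_lt (hN m n hm hn)⟩
  exact ⟨y, tendsto_of_tendsto_riemDist hy⟩

lemma eventually_norm_mfderiv_extChartAt_le (gR : RiemMetric E M) (y : M) :
    ∃ K : ℝ, ∀ᶠ x in 𝓝 y, ∀ v : TangentSpace 𝓘(ℝ, E) x,
      (letI w : E := mfderiv 𝓘(ℝ, E) 𝓘(ℝ, E) (extChartAt 𝓘(ℝ, E) y) x v; ‖w‖)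
        ≤ K * √(gR.inner x v v) := by
  let : Bundle.RiemannianBundle (fun x : M ↦ TangentSpace 𝓘(ℝ, E) x) := ⟨gR.toRiemannianMetric⟩
  have := isContinuousRiemannianBundle gR
  obtain ⟨K, -, hK⟩ := eventually_norm_trivializationAt_lt E
    (fun x : M ↦ TangentSpace 𝓘(ℝ, E) x) y
  refine ⟨K, ?_⟩
  filter_upwards [hK, chart_source_mem_nhds E y] with x hx hxc v
  have h1 : ‖v‖ = √(gR.inner x v v) := norm_eq_sqrt_real_inner v
  rw [← h1, ← TangentBundle.continuousLinearMapAt_trivializationAt hxc]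
  exact ContinuousLinearMap.le_of_opNorm_le _ hx.le v

/-- Near the limit point, `gR` controls the coordinate norm, so the coordinate velocities lie in a
compact ball and converge along a subsequence. -/
theorem Metric.isExtendibleBeyond_of_boundedSpeedOn (g : Metric E M) [FiniteDimensional ℝ E]
    [T2Space M] {γ : ℝ → M} {b : ℝ} (hb : 0 < b) (hγ : g.IsGeodesicOn γ (Ico 0 b))
    {gR : RiemMetric E M} (hgR : IsCompleteMetric gR) (h : BoundedSpeedOn gR γ (Ico 0 b)) :
    g.IsExtendibleBeyond γ b := by
  have := FiniteDimensional.proper ℝ E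
  have : LocallyCompactSpace M := ChartedSpace.locallyCompactSpace E M
  obtain ⟨C, hC⟩ := h
  obtain ⟨s, -, hs, hsb⟩ := exists_seq_strictMono_tendsto' hb
  obtain ⟨y, hy⟩ := exists_tendsto_of_speed_le hgR hγ.1 hC (fun n ↦ Ioo_subset_Ico_self (hs n)) hsb
  obtain ⟨K, hK⟩ := eventually_norm_mfderiv_extChartAt_le gR y
  have hsrc := hy.eventually (extChartAt_source_mem_nhds (I := 𝓘(ℝ, E)) y)
  have hbound : ∀ᶠ n in atTop, (chartLift y γ (s n)).2 ∈ Metric.closedBall (0 : E) (|K| * C) := by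
    filter_upwards [hy.eventually hK, hsrc] with n hn hn'
    have h1 := hn (velocity γ (Ico 0 b) (s n))
    rw [mfderiv_extChartAt_velocity (Ico_mem_nhds (hs n).1 (hs n).2) hγ.1 hn'] at h1
    rw [mem_closedBall_zero_iff]
    refine h1.trans ((mul_le_mul_of_nonneg_right (le_abs_self K) (Real.sqrt_nonneg _)).trans ?_)
    exact mul_le_mul_of_nonneg_left (hC _ (Ioo_subset_Ico_self (hs n))) (abs_nonneg K)
  obtain ⟨w, -, φ, hφ, hw⟩ := (isCompact_closedBall (0 : E) (|K| * C)).tendsto_subseq'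
    hbound.frequently
  refine g.isExtendibleBeyond_of_tendsto_chartLift hγ (p := y) (z₀ := (extChartAt 𝓘(ℝ, E) y y, w))
    (s := s ∘ φ) (mem_extChartAt_target y) (.of_forall fun n ↦ hs _)
    (hsb.comp hφ.tendsto_atTop) (hφ.tendsto_atTop.eventually hsrc) ?_
  exact Tendsto.prodMk_nhds (((continuousAt_extChartAt y).tendsto.comp hy).comp hφ.tendsto_atTop) hw

end BoundedSpeed

end SemiRiemannian

end

theorem mainTheorem4
    {E : Type*} [NormedAddCommGroup E] [NormedSpace ℝ E] [FiniteDimensional ℝ E]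
    {M : Type*} [TopologicalSpace M] [T2Space M] [ConnectedSpace M]
    [ChartedSpace E M] [IsManifold 𝓘(ℝ, E) ∞ M]
    (g : SemiRiemannian.Metric E M) (γ : ℝ → M) (b : ℝ) (hb : 0 < b)
    (hγ : g.IsGeodesicOn γ (Set.Ico 0 b)) :
    List.TFAE [
      g.IsExtendibleBeyond γ b,
      ∃ gR : SemiRiemannian.RiemMetric E M, SemiRiemannian.IsCompleteMetric gR ∧
        SemiRiemannian.BoundedSpeedOn gR γ (Set.Ico 0 b),
      ∀ gR : SemiRiemannian.RiemMetric E M, SemiRiemannian.IsCompleteMetric gR →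
        SemiRiemannian.BoundedSpeedOn gR γ (Set.Ico 0 b),
      ∃ (s : ℕ → ℝ) (v : TangentBundle 𝓘(ℝ, E) M),
        StrictMono s ∧ (∀ n, s n ∈ Set.Ico 0 b) ∧ Filter.Tendsto s Filter.atTop (𝓝 b) ∧
        Filter.Tendsto
          (fun n ↦ (⟨γ (s n), SemiRiemannian.velocity γ (Set.Ico 0 b) (s n)⟩ :
            TangentBundle 𝓘(ℝ, E) M))
          Filter.atTop (𝓝 v)] := by
  tfae_have 1 → 3 := fun h gR _ ↦ SemiRiemannian.boundedSpeedOn_of_isExtendibleBeyond h gR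
  tfae_have 3 → 2 := fun h ↦ by
    -- Without a complete metric on `M`, the statement for all of them could hold vacuously.
    have := g.secondCountableTopology
    obtain ⟨gR, hgR⟩ := SemiRiemannian.exists_isCompleteMetric E M
    exact ⟨gR, hgR, h gR hgR⟩
  tfae_have 2 → 1 := fun ⟨_, hgR, h⟩ ↦ g.isExtendibleBeyond_of_boundedSpeedOn hb hγ hgR h
  tfae_have 1 → 4 := fun h ↦ by
    obtain ⟨v, hv⟩ := SemiRiemannian.tendsto_velocity_of_isExtendibleBeyond hb h
    obtain ⟨s, hmono, hs, hsb⟩ := exists_seq_strictMono_tendsto' hb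
    have hs' := fun n ↦ Set.Ioo_subset_Ico_self (hs n)
    exact ⟨s, v, hmono, hs', hsb, hv s hs' hsb⟩
  tfae_have 4 → 1 := by
    rintro ⟨s, v, hmono, hs, hsb, hv⟩
    refine g.isExtendibleBeyond_of_tendsto_velocity hγ ?_ hsb hv
    -- Only `s 0` may equal the end point `0`, where the velocity is one-sided; all later times are
    -- interior.
    filter_upwards [Filter.eventually_gt_atTop 0] with n hn
    exact ⟨(hs 0).1.trans_lt (hmono hn), (hs n).2⟩
  tfae_finish
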